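/- There is a set $E \subseteq \mathbb{R}$ that is winning for Schmidt's game (indeed $1/3$ winning) but is not Cantor winning. Explicitly, let $\mathbb{N} = \{1,2,\dots\}$. A Bohr set is a set of the form $$A(\gamma,\delta) = \{n \in \mathbb{N} : |n\gamma - k| < \delta \text{ for some } k \in \mathbb{Z}\}, \qquad \gamma, \delta > 0.$$ Let $$E_0 = \Big\{k + \sum_{n \ge 1} \omega_n 2^{-n} : k \in \mathbb{Z},\ \omega \in \{0,1\}^{\mathbb{N}},\ \{n : \omega_n = 1\} \text{ contains a Bohr set}\Big\}, \qquad E = \bigcup_{q \in \mathbb{Q}} q E_0 .$$ Then $E$ is $1/3$ winning (hence winning), its complement $\mathbb{R}\setminus E$ is weak $1/3$ winning, and $E$ is not Cantor winning. Here balls are closed intervals of positive radius. In the $(\alpha,\beta)$ game, $0<\alpha,\beta<1$, Bob chooses a ball $B_0$, and then Alice and Bob alternately choose balls $B_0 \supseteq A_1 \supseteq B_1 \supseteq A_2 \supseteq \cdots$ with $\mathrm{rad}(A_{i+1}) = \alpha\,\mathrm{rad}(B_i)$ and $\mathrm{rad}(B_{i+1}) = \beta\,\mathrm{rad}(A_{i+1})$;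 a set $S$ is $(\alpha,\beta)$ winning if Alice has a strategy ensuring $\bigcap_i B_i \subseteq S$, it is $\alpha$ winning if it is $(\alpha,\beta)$ winning for all $\beta\in(0,1)$, and it is winning if it is $\alpha$ winning for some $\alpha\in(0,1)$. The weak game is the same game except that Alice is only required to satisfy $\mathrm{rad}(A_{i+1}) \ge \alpha\,\mathrm{rad}(B_i)$; weak $\alpha$ winning is defined correspondingly. For an integer $R \ge 1$ and a collection $\mathcal{A}$ of balls, let $\frac1R\mathcal{A}$ be the collection of the balls obtained by cutting each member of $\mathcal{A}$ into $R$ closed intervals of equal length. A $(B_0,R,\mathbf{r})$ Cantor set, where $\mathbf{r} = (r_{m,n})_{0\le m\le n}$ is a family of nonnegative reals, is a set $\bigcap_n \bigcup_{B\in\mathcal{B}_n} B$, where $\mathcal{B}_0=\{B_0\}$, $\mathcal{B}_{n+1} = \frac1R\mathcal{B}_n \setminus \bigcup_{m=0}^n \mathcal{A}_{m,n}$, and $\mathcal{A}_{m,n}\subseteq \frac{1}{R^{n-m+1}}\mathcal{B}_m$ are collections such that every $B\in\mathcal{B}_m$ contains at most $r_{m,n}$ members of $\mathcal{A}_{m,n}$.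 A set $S$ is Cantor winning if there is $\varepsilon_0\in(0,1]$ such that for every ball $B_0$ and every $0<\varepsilon<\varepsilon_0$ there is an integer $R_\varepsilon \ge 1$ such that for every integer $R\ge R_\varepsilon$ the set $S$ contains a $(B_0,R,\mathbf{r})$ Cantor set with $r_{m,n}\le R^{(n-m+1)(1-\varepsilon)}$ for all $0\le m\le n$. -/

import Mathlib

namespace SchmidtCantor

/-! ### Closed balls of the real line -/

/-- A closed ball of `ℝ`, given by its centre and its (positive) radius. -/
@[ext]
structure Ball where
  center : ℝ
  radius : ℝ
  radius_pos : 0 < radius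

/-- The set of points of a ball. -/
def Ball.toSet (B : Ball) : Set ℝ := Metric.closedBall B.center B.radius

/-! ### Schmidt's game and the weak game -/

/-- The moves `B 0, …, B n` of Bob. -/
def history (B : ℕ → Ball) (n : ℕ) : List Ball := (List.range (n + 1)).map B

/-- Alice has a winning strategy, with target set `E`, in the game in which Bob starts with an
arbitrary ball `B 0`, the players alternately choose balls `A 1, B 1, A 2, B 2, …`, the move
`A (n + 1)` is legal if `aliceLegal (B n) (A (n + 1))` holds, and the move `B (n + 1)` is legal if
`bobLegal (A (n + 1)) (B (n + 1))` holds. A strategy `σ` computes `A (n + 1)` from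
`B 0, …, B n`. It wins if, whatever Bob does, all its moves are legal as long as Bob's are, and
`⋂ n, B n ⊆ E` whenever all of Bob's moves are legal. -/
def AliceWins (aliceLegal bobLegal : Ball → Ball → Prop) (E : Set ℝ) : Prop :=
  ∃ σ : List Ball → Ball, ∀ B : ℕ → Ball,
    (∀ n : ℕ, (∀ i < n, bobLegal (σ (history B i)) (B (i + 1))) →
      aliceLegal (B n) (σ (history B n))) ∧
    ((∀ n : ℕ, bobLegal (σ (history B n)) (B (n + 1))) → (⋂ n : ℕ, (B n).toSet) ⊆ E)

/-- `E` is `(α, β)` winning for Schmidt's game. -/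
def IsSchmidtWinningWith (α β : ℝ) (E : Set ℝ) : Prop :=
  AliceWins (fun B A => A.toSet ⊆ B.toSet ∧ A.radius = α * B.radius)
    (fun A B => B.toSet ⊆ A.toSet ∧ B.radius = β * A.radius) E

/-- `E` is `α` winning for Schmidt's game. -/
def IsAlphaWinning (α : ℝ) (E : Set ℝ) : Prop :=
  ∀ β : ℝ, 0 < β → β < 1 → IsSchmidtWinningWith α β E

/-- `E` is winning for Schmidt's game. -/
def IsWinning (E : Set ℝ) : Prop :=
  ∃ α : ℝ, 0 < α ∧ α < 1 ∧ IsAlphaWinning α E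

/-- `E` is `(α, β)` winning for the weak game: Alice's radii are subject to an inequality only,
Bob's to an equality. -/
def IsWeakWinningWith (α β : ℝ) (E : Set ℝ) : Prop :=
  AliceWins (fun B A => A.toSet ⊆ B.toSet ∧ α * B.radius ≤ A.radius)
    (fun A B => B.toSet ⊆ A.toSet ∧ B.radius = β * A.radius) E

/-- `E` is weak `α` winning. -/
def IsWeakAlphaWinning (α : ℝ) (E : Set ℝ) : Prop :=
  ∀ β : ℝ, 0 < β → β < 1 → IsWeakWinningWith α β E

/-! ### Cantor winning sets, for the standard splitting structure of the line -/

/-- The `j`-th ball, from the left, when `B` is cut into `u` intervals of equal length. -/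
noncomputable def Ball.piece (B : Ball) (u : ℕ+) (j : Fin u) : Ball where
  center := B.center - B.radius + (2 * ((j : ℕ) : ℝ) + 1) * (B.radius / ((u : ℕ) : ℝ))
  radius := B.radius / ((u : ℕ) : ℝ)
  radius_pos := div_pos B.radius_pos (Nat.cast_pos.mpr u.pos)

/-- The standard splitting `𝒮(B, u)` of a ball into `f(u) = u` balls. -/
def Ball.splitting (B : Ball) (u : ℕ+) : Set Ball := Set.range (B.piece u)

/-- The collection `(1 / R) 𝒜`. -/
def splitAll (R : ℕ+) (𝒜 : Set Ball) : Set Ball := ⋃ A ∈ 𝒜, A.splitting R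

/-- `K` is a `(B₀, R, r)` Cantor set. The collection `ℬ n` consists of the balls that survive up to
level `n`, and `𝒜 m n` of balls of level `n + 1` that are removed on account of level `m`. Only the
values `𝒜 m n` and `r m n` with `m ≤ n` matter. -/
def IsCantorSet (B₀ : Ball) (R : ℕ+) (r : ℕ → ℕ → ℝ) (K : Set ℝ) : Prop :=
  ∃ (ℬ : ℕ → Set Ball) (𝒜 : ℕ → ℕ → Set Ball),
    ℬ 0 = {B₀} ∧
    (∀ n : ℕ, ℬ (n + 1) = splitAll R (ℬ n) \ ⋃ m ∈ Set.Iic n, 𝒜 m n) ∧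
    (∀ m n : ℕ, m ≤ n → 𝒜 m n ⊆ (splitAll R)^[n - m + 1] (ℬ m)) ∧
    (∀ m n : ℕ, m ≤ n → ∀ B ∈ ℬ m,
      {A ∈ 𝒜 m n | A.toSet ⊆ B.toSet}.Finite ∧
      ({A ∈ 𝒜 m n | A.toSet ⊆ B.toSet}.ncard : ℝ) ≤ r m n) ∧
    K = ⋂ n : ℕ, ⋃ B ∈ ℬ n, B.toSet

/-- `E` is `ε₀` Cantor winning on the ball `B₀`. -/
def IsCantorWinningOn (ε₀ : ℝ) (B₀ : Ball) (E : Set ℝ) : Prop :=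
  ∀ ε : ℝ, 0 < ε → ε < ε₀ → ∃ R₀ : ℕ+, ∀ R : ℕ+, R₀ ≤ R →
    ∃ (r : ℕ → ℕ → ℝ) (K : Set ℝ), IsCantorSet B₀ R r K ∧ K ⊆ E ∧
      ∀ m n : ℕ, m ≤ n →
        0 ≤ r m n ∧ r m n ≤ ((R : ℕ) : ℝ) ^ ((((n - m + 1 : ℕ) : ℝ)) * (1 - ε))

/-- `E` is Cantor winning: for some `ε₀ ∈ (0, 1]`, it is `ε₀` Cantor winning on every ball. -/
def IsCantorWinning (E : Set ℝ) : Prop :=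
  ∃ ε₀ : ℝ, 0 < ε₀ ∧ ε₀ ≤ 1 ∧ ∀ B₀ : Ball, IsCantorWinningOn ε₀ B₀ E

/-! ### Bohr sets and the set of the theorem -/

/-- The set of the positive integers `n` such that `n * γ` lies in `(-δ, δ)` modulo `1`. -/
def bohrSet (γ δ : ℝ) : Set ℕ := {n | 0 < n ∧ ∃ k : ℤ, |(n : ℝ) * γ - (k : ℝ)| < δ}

/-- The set of the positions of the digit `1` in the binary expansion `0.ω₁ω₂ω₃…`, where the digit
`ωₙ`, of weight `2⁻ⁿ`, is `ω (n - 1)`, as in `Real.ofDigits`. -/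
def digitSet (ω : ℕ → Fin 2) : Set ℕ := {n | 0 < n ∧ ω (n - 1) = 1}

/-- The numbers `k + 0.ω₁ω₂ω₃…` with `k` an integer and the digit set of `ω` containing a
Bohr set. -/
noncomputable def bohrDigitPoints : Set ℝ :=
  {x | ∃ (k : ℤ) (ω : ℕ → Fin 2), (∃ γ δ : ℝ, 0 < γ ∧ 0 < δ ∧ bohrSet γ δ ⊆ digitSet ω) ∧
    x = (k : ℝ) + Real.ofDigits ω}

/-- The union of the dilates `q * bohrDigitPoints` over the rational numbers `q`. -/
noncomputable def bohrDilates : Set ℝ :=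
  {x | ∃ (q : ℚ), ∃ y ∈ bohrDigitPoints, x = (q : ℝ) * y}

end SchmidtCantor

namespace SchmidtCantor

open Filter Topology

/-! ### Binary digits -/

/-! The digit of `y` at position `m` is the parity of the integer part of `2 ^ m * y`, up to the
ambiguity at endpoints. Hence digit `1` (or `0`) of `x / q` at position `m` is a condition on `x` at
scale `q * 2 ^ (-m)`: it must lie in an odd (or even) interval of that length.

Winning. In the exact game the radius after `n` turns is `r₀ * (β / 3) ^ n`, so the `n`-th turn
takes place at binary scale `n * logb 2 (3 / β)`. The positions `m` close to even-numbered turns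
form a Bohr set. A rational `q` adapts the grid to `r₀` so that at these turns Bob's radius is about
`3 / 2` of an interval, and Alice's ball just fills an odd interval of her choice. The odd-numbered
turns serve to leave the endpoints.

The complement. By Dirichlet's theorem, every Bohr set meets `{j * k! | 1 ≤ j ≤ k}` once `k` is
large. Digits `0` of `x / q` at these positions, for infinitely many `k` for each `q ≠ 0`, therefore
exclude `x` from the set (`exists_sparse_scales`). The resulting scales are as sparse as desired. In
the weak game Alice can tune the radii to hit each scale exactly (`exists_radii`) and then fill an
even interval.

Not Cantor winning. The same sparse scales defeat every Cantor construction with few removals.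
Keeping only nodes inside even intervals costs a bounded factor at rare levels, while the removals
cost a geometrically small proportion. Nodes survive at all levels (`survivors_nonempty`), and by
compactness the Cantor set has a point outside the target set. -/

lemma exists_two_pow_mul_sum_ofDigitsTerm (ω : ℕ → Fin 2) (n : ℕ) :
    ∃ l : ℤ, (2 : ℝ) ^ n * ∑ i ∈ Finset.range n, Real.ofDigitsTerm ω i = l := by
  induction n with
  | zero => exact ⟨0, by simp⟩
  | succ n ih =>
    obtain ⟨l, hl⟩ := ih
    refine ⟨2 * l + ((ω n : ℕ) : ℤ), ?_⟩
    rw [Finset.sum_range_succ, mul_add, pow_succ', mul_assoc, hl, Real.ofDigitsTerm]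
    push_cast
    field_simp
    ring

/-- The parity of the integer part of `2 ^ m * x` is given by the `m`-th digit of `x`. -/
lemma exists_two_pow_mul_mem_Icc (k : ℤ) (ω : ℕ → Fin 2) {m : ℕ} (hm : 0 < m) :
    ∃ l : ℤ, (2 : ℝ) ^ m * (k + Real.ofDigits ω) ∈
      Set.Icc (2 * l + ((ω (m - 1) : ℕ) : ℝ)) (2 * l + ((ω (m - 1) : ℕ) : ℝ) + 1) := by
  obtain ⟨n, rfl⟩ := Nat.exists_eq_add_of_lt hm
  simp only [zero_add, Nat.add_sub_cancel]
  obtain ⟨l, hl⟩ := exists_two_pow_mul_sum_ofDigitsTerm ω n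
  have h0 := Real.ofDigits_nonneg (fun i ↦ ω (i + (n + 1)))
  have h1 := Real.ofDigits_le_one (fun i ↦ ω (i + (n + 1)))
  refine ⟨2 ^ n * k + l, ?_⟩
  have key : (2 : ℝ) ^ (n + 1) * (k + Real.ofDigits ω) = 2 * (2 ^ n * k + l) + ((ω n : ℕ) : ℝ) +
      Real.ofDigits (fun i ↦ ω (i + (n + 1))) := by
    rw [Real.ofDigits_eq_sum_add_ofDigits ω (n + 1), Finset.sum_range_succ, ← hl,
      Real.ofDigitsTerm]
    push_cast
    field_simp
    ring
  rw [key]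
  push_cast
  constructor <;> linarith

/-- A number is a binary digit expansion up to an integer. -/
lemma exists_eq_add_ofDigits (y : ℝ) : ∃ ω : ℕ → Fin 2, y = (⌊y⌋ : ℝ) + Real.ofDigits ω := by
  refine ⟨Real.digits (Int.fract y) 2, ?_⟩
  rw [Real.ofDigits_digits one_lt_two ⟨Int.fract_nonneg y, Int.fract_lt_one y⟩, Int.floor_add_fract]

lemma fin_two_cases (a : Fin 2) : a = 0 ∨ a = 1 := by
  fin_cases a <;> simp

/-- A criterion for membership in the set of the theorem. -/
lemma mem_bohrDilates_of_odd (q : ℚ) (hq : q ≠ 0) {γ δ x : ℝ} (hγ : 0 < γ) (hδ : 0 < δ)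
    (h : ∀ m ∈ bohrSet γ δ, ∃ l : ℤ, 2 * (l : ℝ) + 1 < 2 ^ m * (x / q) ∧
      2 ^ m * (x / q) < 2 * (l : ℝ) + 2) :
    x ∈ bohrDilates := by
  obtain ⟨ω, hω⟩ := exists_eq_add_ofDigits (x / q)
  have hq' : (q : ℝ) ≠ 0 := by exact_mod_cast hq
  refine ⟨q, x / q, ⟨⌊x / q⌋, ω, ⟨γ, δ, hγ, hδ, fun m hm ↦ ⟨hm.1, ?_⟩⟩, hω⟩, by field_simp⟩
  obtain ⟨l, h1, h2⟩ := h m hm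
  obtain ⟨l', h3, h4⟩ := exists_two_pow_mul_mem_Icc ⌊x / q⌋ ω hm.1
  rw [← hω] at h3 h4
  -- By the strict bounds in `h`, digit `0` would put `l'` strictly between `l` and `l + 1`.
  rcases fin_two_cases (ω (m - 1)) with h0 | h0
  · rw [h0] at h3 h4
    simp only [Fin.val_zero, Nat.cast_zero, add_zero] at h3 h4
    have h5 : l' < l + 1 := by
      have : (2 * l' : ℝ) < 2 * l + 2 := by linarith
      have : (l' : ℝ) < l + 1 := by linarith
      exact_mod_cast this
    have h6 : l < l' := by
      have : (l : ℝ) < l' := by linarith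
      exact_mod_cast this
    lia
  · exact h0

/-! ### Even positions that exclude a number from the set of the theorem -/

/-- A sequence in which every nonzero rational occurs infinitely often, with controlled growth. -/
lemma exists_rat_enumeration : ∃ q : ℕ → ℚ, (∀ k, q k ≠ 0) ∧
    (∀ k : ℕ, 1 / ((k : ℝ) + 1) ≤ |(q k : ℝ)|) ∧ (∀ k : ℕ, |(q k : ℝ)| ≤ k + 1) ∧
    ∀ a : ℚ, a ≠ 0 → ∀ n, ∃ k ≥ n, q k = a := by
  classical
  obtain ⟨f, hf⟩ := exists_surjective_nat ℚ
  let good : ℕ → ℚ → Prop := fun k a ↦ a ≠ 0 ∧ 1 / ((k : ℝ) + 1) ≤ |(a : ℝ)| ∧ |(a : ℝ)| ≤ k + 1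
  -- Pairing proposes each rational at infinitely many `k`; the value `1` replaces a proposal that
  -- is zero or violates the bounds at `k`.
  let q : ℕ → ℚ := fun k ↦ if good k (f (Nat.unpair k).1) then f (Nat.unpair k).1 else 1
  have hq : ∀ k, good k (q k) := by
    intro k
    by_cases h : good k (f (Nat.unpair k).1)
    · simpa only [q, if_pos h] using h
    · simp only [q, if_neg h]
      refine ⟨one_ne_zero, ?_, ?_⟩
      · rw [div_le_iff₀ (by positivity)]
        simp
      · simp
  refine ⟨q, fun k ↦ (hq k).1, fun k ↦ (hq k).2.1, fun k ↦ (hq k).2.2, fun a ha n ↦ ?_⟩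
  obtain ⟨i, rfl⟩ := hf a
  have ha' : 0 < |(f i : ℝ)| := by simpa using ha
  obtain ⟨b₁, hb₁⟩ := exists_nat_ge |(f i : ℝ)|
  obtain ⟨b₂, hb₂⟩ := exists_nat_ge (1 / |(f i : ℝ)|)
  let b := max n (max b₁ b₂)
  have hk : b ≤ Nat.pair i b := Nat.right_le_pair i b
  have hk' : (b : ℝ) ≤ Nat.pair i b := by exact_mod_cast hk
  have h1 : (b₁ : ℝ) ≤ b := by exact_mod_cast (le_max_left _ _).trans (le_max_right _ _)
  have h2 : (b₂ : ℝ) ≤ b := by exact_mod_cast (le_max_right _ _).trans (le_max_right _ _)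
  refine ⟨Nat.pair i b, (le_max_left _ _).trans hk, ?_⟩
  have hg : good (Nat.pair i b) (f i) := by
    refine ⟨ha, ?_, by linarith⟩
    rw [div_le_iff₀ (by positivity)]
    rw [div_le_iff₀ ha'] at hb₂
    nlinarith
  simp only [q, Nat.unpair_pair, if_pos hg]

/-- The index after `(k, j)` in the lexicographic order of `{(k, j) | 1 ≤ j ≤ k}`. -/
def nextIndex (p : ℕ × ℕ) : ℕ × ℕ := if p.2 < p.1 then (p.1, p.2 + 1) else (p.1 + 1, 1)

lemma exists_iterate_nextIndex {k₀ k j : ℕ} (hk : k₀ ≤ k) (hj : 1 ≤ j) (hjk : j ≤ k) :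
    ∃ i, nextIndex^[i] (k₀, 1) = (k, j) := by
  induction k, hk using Nat.le_induction generalizing j with
  | base =>
    induction j, hj using Nat.le_induction with
    | base => exact ⟨0, rfl⟩
    | succ j hj ih =>
      obtain ⟨i, hi⟩ := ih (by lia)
      refine ⟨i + 1, ?_⟩
      rw [Function.iterate_succ_apply', hi, nextIndex, if_pos (by simpa using hjk)]
  | succ k hk ih' =>
    induction j, hj using Nat.le_induction with
    | base =>
      rcases Nat.eq_zero_or_pos k with rfl | hk0
      · obtain rfl : k₀ = 0 := by lia
        exact ⟨1, by simp [nextIndex]⟩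
      · obtain ⟨i, hi⟩ := ih' hk0 le_rfl
        refine ⟨i + 1, ?_⟩
        rw [Function.iterate_succ_apply', hi, nextIndex, if_neg (by simp)]
    | succ j hj ih =>
      obtain ⟨i, hi⟩ := ih (by lia)
      refine ⟨i + 1, ?_⟩
      rw [Function.iterate_succ_apply', hi, nextIndex, if_pos (by simpa using hjk)]

lemma one_le_iterate_nextIndex {k₀ : ℕ} (hk₀ : 1 ≤ k₀) (i : ℕ) :
    k₀ ≤ (nextIndex^[i] (k₀, 1)).1 ∧ 1 ≤ (nextIndex^[i] (k₀, 1)).2 ∧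
      (nextIndex^[i] (k₀, 1)).2 ≤ (nextIndex^[i] (k₀, 1)).1 := by
  induction i with
  | zero => simpa using hk₀
  | succ i ih =>
    rw [Function.iterate_succ_apply']
    generalize nextIndex^[i] (k₀, 1) = p at ih
    unfold nextIndex
    split_ifs <;> simp <;> lia

/-- There are arbitrarily sparse sequences of scales such that no number whose binary digits at
all of these scales are `0` belongs to the set of the theorem. -/
lemma exists_sparse_scales {c : ℝ} (hc : 0 < c) : ∃ t : ℕ → ℝ, (∀ i, t i ≠ 0) ∧ |t 0| ≤ c ∧
    (∀ i, |t (i + 1)| ≤ c * |t i|) ∧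
    ∀ x : ℝ, (∀ i, ∃ j : ℤ, 2 * (j : ℝ) < x / t i ∧ x / t i < 2 * (j : ℝ) + 1) →
      x ∉ bohrDilates := by
  obtain ⟨q, hq0, hq1, hq2, hq3⟩ := exists_rat_enumeration
  have hlim : Tendsto (fun k : ℕ ↦ ((k : ℝ) + 2) ^ 2 * (1 / 2) ^ k) atTop (𝓝 0) := by
    have h : ∀ p : ℕ, Tendsto (fun k : ℕ ↦ (k : ℝ) ^ p * (1 / 2 : ℝ) ^ k) atTop (𝓝 0) := fun p ↦
      tendsto_pow_const_mul_const_pow_of_lt_one p (by norm_num) (by norm_num)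
    have := ((h 2).add ((h 1).const_mul 4)).add ((h 0).const_mul 4)
    simp only [mul_zero, add_zero] at this
    refine this.congr fun k ↦ ?_
    ring
  obtain ⟨k₁, hk₁⟩ := eventually_atTop.1 (hlim.eventually (gt_mem_nhds hc))
  let k₀ := max k₁ 1
  have hk₀ : 1 ≤ k₀ := le_max_right _ _
  let g : ℕ → ℕ × ℕ := fun i ↦ nextIndex^[i] (k₀, 1)
  -- `x / s (k, j) = 2 ^ (j * k!) * (x / q k)`, whose integer part has the parity of the digit of `x
  -- / q k` at position `j * k!`.
  let s : ℕ × ℕ → ℝ := fun p ↦ (q p.1 : ℝ) * (1 / 2) ^ (p.2 * p.1.factorial)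
  have hq0' : ∀ k, (q k : ℝ) ≠ 0 := fun k ↦ by exact_mod_cast hq0 k
  have hhalf : ∀ {k n : ℕ}, k ≤ n → (1 / 2 : ℝ) ^ n ≤ (1 / 2) ^ k := fun h ↦
    pow_le_pow_of_le_one (by norm_num) (by norm_num) h
  have hsmall : ∀ k ≥ k₀, ((k : ℝ) + 2) * (k + 1) * (1 / 2) ^ k.factorial ≤ c := by
    intro k hk
    refine le_trans ?_ (hk₁ k ((le_max_left _ _).trans hk)).le
    rw [sq]
    gcongr ?_ * ?_ * ?_
    · linarith
    · exact hhalf (Nat.self_le_factorial k)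
  have habs : ∀ p, |s p| = |(q p.1 : ℝ)| * (1 / 2) ^ (p.2 * p.1.factorial) := fun p ↦ by
    simp only [s, abs_mul]
    rw [abs_of_pos (a := (1 / 2 : ℝ) ^ _) (by positivity)]
  refine ⟨fun i ↦ s (g i), fun i ↦ mul_ne_zero (hq0' _) (by positivity), ?_, fun i ↦ ?_, ?_⟩
  · rw [habs]
    refine le_trans ?_ (hsmall k₀ le_rfl)
    simp only [g, Function.iterate_zero, id, one_mul]
    gcongr
    have := hq2 k₀
    nlinarith [Nat.cast_nonneg (α := ℝ) k₀]
  · obtain ⟨h1, h2, h3⟩ := one_le_iterate_nextIndex hk₀ i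
    have hstep : g (i + 1) = nextIndex (g i) := Function.iterate_succ_apply' _ _ _
    change k₀ ≤ (g i).1 at h1
    change 1 ≤ (g i).2 at h2
    change (g i).2 ≤ (g i).1 at h3
    rw [habs, habs, hstep]
    generalize g i = p at h1 h2 h3
    obtain ⟨k, j⟩ := p
    simp only at h1 h2 h3
    have hpos : 0 < |(q k : ℝ)| := abs_pos.2 (hq0' k)
    rw [← mul_assoc]
    unfold nextIndex
    split_ifs with h
    · have h4 : (1 / 2 : ℝ) ^ k.factorial ≤ c := by
        refine le_trans ?_ (hsmall k h1)
        refine le_mul_of_one_le_left (by positivity) ?_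
        nlinarith [Nat.cast_nonneg (α := ℝ) k]
      calc |(q k : ℝ)| * (1 / 2) ^ ((j + 1) * k.factorial)
          = (1 / 2) ^ k.factorial * (|(q k : ℝ)| * (1 / 2) ^ (j * k.factorial)) := by ring
        _ ≤ c * (|(q k : ℝ)| * (1 / 2) ^ (j * k.factorial)) := by gcongr
        _ = _ := by ring
    -- Since `(k + 1)! - k * k! = k!`, passing to the next block gains the same factor `2 ^ (-k!)`
    -- as a step inside the block; the change of rational costs at most `(k + 2) * (k + 1)`.
    · have hjk : j = k := by simp at h; lia
      subst hjk
      have h4 := hq2 (j + 1)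
      have h5 := hq1 j
      rw [div_le_iff₀ (by positivity)] at h5
      have h6 : |(q (j + 1) : ℝ)| * (1 / 2) ^ j.factorial ≤ c * |(q j : ℝ)| := by
        calc |(q (j + 1) : ℝ)| * (1 / 2) ^ j.factorial
            ≤ ((j : ℝ) + 2) * (|(q j : ℝ)| * (j + 1)) * (1 / 2) ^ j.factorial := by
              gcongr
              push_cast at h4
              nlinarith [Nat.cast_nonneg (α := ℝ) j]
          _ = ((j : ℝ) + 2) * (j + 1) * (1 / 2) ^ j.factorial * |(q j : ℝ)| := by ring
          _ ≤ c * |(q j : ℝ)| := by gcongr; exact hsmall j h1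
      simp only [one_mul, Nat.factorial_succ]
      calc |(q (j + 1) : ℝ)| * (1 / 2) ^ ((j + 1) * j.factorial)
          = |(q (j + 1) : ℝ)| * (1 / 2) ^ j.factorial * (1 / 2) ^ (j * j.factorial) := by ring
        _ ≤ c * |(q j : ℝ)| * (1 / 2) ^ (j * j.factorial) := by gcongr
  · rintro x hx ⟨a, y, ⟨k, ω, ⟨γ, δ, hγ, hδ, hω⟩, hy⟩, hxy⟩
    rcases eq_or_ne a 0 with rfl | ha
    · obtain ⟨j, h1, h2⟩ := hx 0
      simp only [hxy, Rat.cast_zero, zero_mul, zero_div] at h1 h2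
      have h3 : 2 * j < 0 := by exact_mod_cast h1
      have h4 : 0 < 2 * j + 1 := by exact_mod_cast h2
      lia
    · obtain ⟨K, hK⟩ := exists_nat_gt (1 / δ)
      obtain ⟨n, hn, hqn⟩ := hq3 a ha (max K k₀)
      have hn0 : 0 < n := hk₀.trans ((le_max_right _ _).trans hn)
      -- Dirichlet's theorem for `n! * γ` finds an element `j * n!` of the Bohr set with `1 ≤ j ≤
      -- n`.
      obtain ⟨j, hj0, hjn, hj⟩ := Real.exists_nat_abs_mul_sub_round_le (n.factorial * γ) hn0
      obtain ⟨i, hi⟩ := exists_iterate_nextIndex (k₀ := k₀) ((le_max_right _ _).trans hn) hj0 hjn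
      have hm : 0 < j * n.factorial := Nat.mul_pos hj0 (Nat.factorial_pos n)
      have hd : ω (j * n.factorial - 1) = 1 := by
        refine (hω ⟨hm, round ((j : ℝ) * (n.factorial * γ)), ?_⟩).2
        push_cast
        rw [mul_assoc]
        refine hj.trans_lt ?_
        have hKn : (K : ℝ) ≤ n := by exact_mod_cast (le_max_left _ _).trans hn
        rw [div_lt_iff₀ hδ] at hK
        rw [div_lt_iff₀ (by positivity)]
        nlinarith
      obtain ⟨l, h1, h2⟩ := exists_two_pow_mul_mem_Icc k ω hm
      obtain ⟨l', h3, h4⟩ := hx i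
      have ha' : (a : ℝ) ≠ 0 := by exact_mod_cast ha
      have hval : x / s (g i) = 2 ^ (j * n.factorial) * (k + Real.ofDigits ω) := by
        simp only [g, hi, s, hqn, hxy, hy, one_div, inv_pow]
        field_simp
      rw [hval] at h3 h4
      rw [hd] at h1 h2
      simp only [Fin.val_one, Nat.cast_one] at h1 h2
      have h5 : l < l' := by
        have : (l : ℝ) < l' := by linarith
        exact_mod_cast this
      have h6 : l' < l + 1 := by
        have : (l' : ℝ) < l + 1 := by linarith
        exact_mod_cast this
      lia

/-! ### Strategies -/

/-- Alice wins if, for each initial ball, there is a rule for her moves, depending on the number of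
the turn and on Bob's last move only, that can always be obeyed and leads into the target set. -/
lemma aliceWins_of_rule {aliceLegal bobLegal : Ball → Ball → Prop} {E : Set ℝ}
    (h : ∀ B₀ : Ball, ∃ P : ℕ → Ball → Ball → Prop,
      (∀ n B, ∃ A, aliceLegal B A ∧ P n B A) ∧
      ∀ B A : ℕ → Ball, B 0 = B₀ → (∀ n, aliceLegal (B n) (A n)) → (∀ n, P n (B n) (A n)) →
        (∀ n, bobLegal (A n) (B (n + 1))) → (⋂ n : ℕ, (B n).toSet) ⊆ E) :
    AliceWins aliceLegal bobLegal E := by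
  choose P hP hE using h
  choose f hf using hP
  -- A default that is never returned, histories being nonempty.
  let b : Ball := ⟨0, 1, one_pos⟩
  have hist : ∀ (B : ℕ → Ball) n, (history B n).headD b = B 0 ∧
      (history B n).length - 1 = n ∧ (history B n).getLastD b = B n := by
    intro B n
    refine ⟨?_, by simp [history], ?_⟩
    · simp [history, List.range_succ_eq_map]
    · simp [history, List.range_succ]
  let σ : List Ball → Ball := fun l ↦ f (l.headD b) (l.length - 1) (l.getLastD b)
  have hσ : ∀ B n, σ (history B n) = f (B 0) n (B n) := by
    intro B n
    obtain ⟨h1, h2, h3⟩ := hist B n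
    simp only [σ, h1, h2, h3]
  refine ⟨σ, fun B ↦ ⟨fun n _ ↦ ?_, fun hB ↦ ?_⟩⟩
  · rw [hσ]
    exact (hf _ _ _).1
  · simp only [hσ] at hB
    exact hE (B 0) B (fun n ↦ f (B 0) n (B n)) rfl (fun n ↦ (hf _ _ _).1)
      (fun n ↦ (hf _ _ _).2) hB

/-- Containment of balls. -/
lemma Ball.toSet_subset {A B : Ball} : A.toSet ⊆ B.toSet ↔
    B.center - B.radius ≤ A.center - A.radius ∧ A.center + A.radius ≤ B.center + B.radius := by
  simp only [Ball.toSet, Real.closedBall_eq_Icc]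
  rw [Set.Icc_subset_Icc_iff (by linarith [A.radius_pos])]

lemma Ball.mem_toSet {B : Ball} {x : ℝ} :
    x ∈ B.toSet ↔ B.center - B.radius ≤ x ∧ x ≤ B.center + B.radius := by
  simp only [Ball.toSet, Real.closedBall_eq_Icc, Set.mem_Icc]

/-! ### The complement is weak `1 / 3` winning -/

lemma exists_int_abs_sub_le {t : ℝ} (ht : t ≠ 0) (θ x : ℝ) :
    ∃ j : ℤ, |(2 * j + θ) * t - x| ≤ |t| := by
  refine ⟨round ((x / t - θ) / 2), ?_⟩
  have h := abs_sub_round ((x / t - θ) / 2)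
  set j := round ((x / t - θ) / 2)
  have h1 : (2 * (j : ℝ) + θ) * t - x = -2 * ((x / t - θ) / 2 - j) * t := by
    field_simp
    ring
  rw [h1, abs_mul, abs_mul]
  norm_num
  nlinarith [abs_pos.2 ht]

/-- All small enough ratios are products of factors between `β / 3` and `β / 2`. -/
lemma exists_pow_le_le_pow {β : ℝ} (hβ0 : 0 < β) (hβ1 : β < 1) : ∃ c : ℝ, 0 < c ∧ c < 1 ∧
    ∀ u, 0 < u → u ≤ c → ∃ n : ℕ, n ≠ 0 ∧ (β / 3) ^ n ≤ u ∧ u ≤ (β / 2) ^ n := by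
  obtain ⟨m, hm⟩ := exists_pow_lt_of_lt_one (x := β / 2) (by positivity)
    (show (2 / 3 : ℝ) < 1 by norm_num)
  -- For `n ≥ m` one has `(2 / 3) ^ n ≤ β / 2`, that is `(β / 3) ^ n ≤ (β / 2) ^ (n + 1)`, so
  -- consecutive intervals `[(β / 3) ^ n, (β / 2) ^ n]` overlap.
  refine ⟨(β / 3) ^ (m + 1), by positivity, pow_lt_one₀ (by positivity) (by linarith) (by simp),
    fun u hu hum ↦ ?_⟩
  obtain ⟨n, hn1, hn2⟩ := exists_nat_pow_near_of_lt_one hu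
    (hum.trans (pow_le_one₀ (by positivity) (by linarith))) (y := β / 3) (by positivity)
    (by linarith)
  have hmn : m ≤ n := by
    by_contra! h
    exact (hn1.trans_le hum).not_ge
      (pow_le_pow_of_le_one (by positivity) (by linarith) (by lia))
  refine ⟨n + 1, by simp, hn1.le, hn2.trans ?_⟩
  have h1 : (2 / 3 : ℝ) ^ n ≤ β / 2 :=
    (pow_le_pow_of_le_one (by norm_num) (by norm_num) hmn).trans hm.le
  calc (β / 3) ^ n = (2 / 3) ^ n * (β / 2) ^ n := by rw [← mul_pow]; ring_nf
    _ ≤ β / 2 * (β / 2) ^ n := by gcongr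
    _ = _ := by ring

/-- Alice can fix the radii of all moves in advance so that prescribed sparse radii occur. -/
lemma exists_radii {β : ℝ} (hβ0 : 0 < β) (hβ1 : β < 1) : ∃ c : ℝ, 0 < c ∧
    ∀ r₀ : ℝ, 0 < r₀ → ∀ T : ℕ → ℝ, (∀ i, 0 < T i) → T 0 ≤ c * r₀ → (∀ i, T (i + 1) ≤ c * T i) →
    ∃ (r : ℕ → ℝ) (N : ℕ → ℕ), r 0 = r₀ ∧ (∀ n, 0 < r n) ∧
      (∀ n, β / 3 * r n ≤ r (n + 1) ∧ r (n + 1) ≤ β / 2 * r n) ∧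
      (∀ i, r (N i) = T i ∧ r (N i + 1) = β / 3 * T i) ∧ Function.Injective N ∧
      ∀ i j, N j ≠ N i + 1 := by
  obtain ⟨c, hc0, hc1, hc⟩ := exists_pow_le_le_pow hβ0 hβ1
  -- The factor `β / 3` pays for the forced step after each target radius.
  refine ⟨c * (β / 3), by positivity, fun r₀ hr₀ T hT hT0 hTs ↦ ?_⟩
  have hc3 : c * (β / 3) < β / 3 := by nlinarith
  have hL : ∀ i, ∃ n : ℕ, n ≠ 0 ∧ (β / 3) ^ n * (β / 3 * T i) ≤ T (i + 1) ∧
      T (i + 1) ≤ (β / 2) ^ n * (β / 3 * T i) := by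
    intro i
    have hp : 0 < β / 3 * T i := mul_pos (by positivity) (hT i)
    obtain ⟨n, hn, h1, h2⟩ := hc (T (i + 1) / (β / 3 * T i)) (div_pos (hT _) hp)
      (by rw [div_le_iff₀ hp]; linarith [hTs i])
    exact ⟨n, hn, (le_div_iff₀ hp).1 h1, (div_le_iff₀ hp).1 h2⟩
  choose L hL0 hL1 hL2 using hL
  obtain ⟨ℓ₀, -, h01, h02⟩ := hc (T 0 / r₀) (div_pos (hT _) hr₀)
    (by rw [div_le_iff₀ hr₀]; nlinarith [mul_pos hc0 hr₀])
  rw [le_div_iff₀ hr₀] at h01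
  rw [div_le_iff₀ hr₀] at h02
  -- A state holds the index of the next target, the number of steps left to reach it, and the
  -- current radius. The new radius is the least permitted one from which the factor `β / 2` still
  -- suffices to stay above the target; `inv` says that the target remains reachable.
  let step : ℕ × ℕ × ℝ → ℕ × ℕ × ℝ := fun s ↦
    if s.2.1 = 0 then (s.1 + 1, L s.1, β / 3 * s.2.2)
    else (s.1, s.2.1 - 1, max (β / 3 * s.2.2) (T s.1 / (β / 2) ^ (s.2.1 - 1)))
  let inv : ℕ × ℕ × ℝ → Prop := fun s ↦ 0 < s.2.2 ∧ (β / 3) ^ s.2.1 * s.2.2 ≤ T s.1 ∧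
    T s.1 ≤ (β / 2) ^ s.2.1 * s.2.2
  have hstep : ∀ s, inv s → inv (step s) ∧ β / 3 * s.2.2 ≤ (step s).2.2 ∧
      (step s).2.2 ≤ β / 2 * s.2.2 := by
    rintro ⟨i, ℓ, r⟩ ⟨hr, h1, h2⟩
    simp only at hr h1 h2
    rcases Nat.eq_zero_or_pos ℓ with rfl | hℓ
    · have hrT : r = T i := by simp at h1 h2; linarith
      simp only [step, inv, if_true]
      rw [hrT]
      exact ⟨⟨mul_pos (by positivity) (hT i), hL1 i, hL2 i⟩, le_rfl, by nlinarith [hT i]⟩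
    · obtain ⟨k, rfl⟩ := Nat.exists_eq_add_of_lt hℓ
      simp only [zero_add] at h1 h2 ⊢
      simp only [step, inv, Nat.add_sub_cancel, Nat.succ_ne_zero, if_false]
      have hb2 : 0 < (β / 2) ^ k := by positivity
      refine ⟨⟨lt_max_of_lt_left (by positivity), ?_, ?_⟩, le_max_left _ _, ?_⟩
      · rw [mul_max_of_nonneg _ _ (by positivity)]
        refine max_le ?_ ?_
        · rw [pow_succ] at h1
          linarith
        · rw [mul_div_assoc', div_le_iff₀ hb2, mul_comm]
          have := hT i
          gcongr
          linarith
      · rw [← div_le_iff₀' hb2]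
        exact le_max_right _ _
      · refine max_le (by nlinarith) ?_
        rw [div_le_iff₀ hb2]
        rw [pow_succ] at h2
        linarith
  let f : ℕ → ℕ × ℕ × ℝ := fun n ↦ step^[n] (0, ℓ₀, r₀)
  have hf : ∀ n, f (n + 1) = step (f n) := fun n ↦ Function.iterate_succ_apply' _ _ _
  have hinv : ∀ n, inv (f n) := by
    intro n
    induction n with
    | zero => exact ⟨hr₀, h01, h02⟩
    | succ n ih =>
      rw [hf]
      exact (hstep _ ih).1
  have hdown : ∀ (ℓ n i : ℕ), (f n).1 = i → (f n).2.1 = ℓ →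
      ∃ m, (f m).1 = i ∧ (f m).2.1 = 0 := by
    intro ℓ
    induction ℓ with
    | zero => exact fun n i h1 h2 ↦ ⟨n, h1, h2⟩
    | succ ℓ ih =>
      intro n i h1 h2
      refine ih (n + 1) i ?_ ?_ <;> rw [hf] <;> simp [step, h1, h2]
  have hgoal : ∀ i, ∃ n, (f n).1 = i ∧ (f n).2.1 = 0 := by
    intro i
    induction i with
    | zero => exact hdown ℓ₀ 0 0 rfl rfl
    | succ i ih =>
      obtain ⟨n, h1, h2⟩ := ih
      refine hdown (L i) (n + 1) (i + 1) ?_ ?_ <;> rw [hf] <;> simp [step, h1, h2]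
  choose N hN1 hN2 using hgoal
  have hrN : ∀ i, (f (N i)).2.2 = T i := by
    intro i
    obtain ⟨-, h1, h2⟩ := hinv (N i)
    rw [hN1, hN2, pow_zero, one_mul] at h1 h2
    exact le_antisymm h1 h2
  refine ⟨fun n ↦ (f n).2.2, N, rfl, fun n ↦ (hinv n).1, fun n ↦ ?_, fun i ↦ ⟨hrN i, ?_⟩,
    fun i j hij ↦ ?_, fun i j hij ↦ ?_⟩
  · simp only [hf]
    exact (hstep _ (hinv n)).2
  · simp only [hf, step, hN2, if_true, hrN]
  · rw [← hN1 i, ← hN1 j, hij]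
  · have := hN2 j
    rw [hij, hf] at this
    simp [step, hN2, hN1, hL0] at this

/-- If a set contains all numbers that have digit `0` at arbitrarily sparse scales, then it is weak
`1 / 3` winning. -/
lemma isWeakAlphaWinning_of_sparse_scales {E : Set ℝ}
    (hE : ∀ c : ℝ, 0 < c → ∃ t : ℕ → ℝ, (∀ i, t i ≠ 0) ∧ |t 0| ≤ c ∧
      (∀ i, |t (i + 1)| ≤ c * |t i|) ∧
      ∀ x : ℝ, (∀ i, ∃ j : ℤ, 2 * (j : ℝ) < x / t i ∧ x / t i < 2 * (j : ℝ) + 1) → x ∈ E) :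
    IsWeakAlphaWinning (1 / 3) E := by
  intro β hβ0 hβ1
  obtain ⟨c, hc0, hc⟩ := exists_radii hβ0 hβ1
  refine aliceWins_of_rule fun B₀ ↦ ?_
  have hr₀ := B₀.radius_pos
  obtain ⟨t, ht0, ht1, ht2, htE⟩ := hE (min c (2 / 3 * c * B₀.radius)) (by positivity)
  have htp : ∀ i, 0 < |t i| := fun i ↦ abs_pos.2 (ht0 i)
  obtain ⟨r, N, hr0, hrp, hr, hrN, hinj, hne⟩ := hc B₀.radius hr₀ (fun i ↦ 3 / 2 * |t i|)
    (fun i ↦ by have := htp i; positivity) (by linarith [ht1.trans (min_le_right _ _)])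
    (fun i ↦ by
      have := (ht2 i).trans (mul_le_mul_of_nonneg_right (min_le_left _ _) (htp i).le)
      linarith)
  -- At turn `N i` the radius is `3 / 2 * |t i|`, so a ball of a third of it exactly fills an even
  -- interval of length `|t i|`, and Alice's room `|t i|` to shift reaches the nearest one.
  refine ⟨fun n B A ↦ B.radius = r n → A.radius = r (n + 1) / β ∧
    (∀ i, N i = n → ∃ j : ℤ, A.center = (2 * j + 1 / 2) * t i) ∧
    ((∀ i, N i ≠ n) → A.center = B.center), fun n B ↦ ?_, fun B A hB0 hleg hP hbob ↦ ?_⟩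
  · by_cases hBr : B.radius = r n
    · have hpos : 0 < r (n + 1) / β := div_pos (hrp _) hβ0
      obtain ⟨h1, h2⟩ := hr n
      have h1' : 1 / 3 * r n ≤ r (n + 1) / β := by rw [le_div_iff₀ hβ0]; linarith
      have h2' : r (n + 1) / β ≤ 1 / 2 * r n := by rw [div_le_iff₀ hβ0]; linarith
      by_cases hn : ∃ i, N i = n
      · obtain ⟨i, rfl⟩ := hn
        obtain ⟨j, hj⟩ := exists_int_abs_sub_le (ht0 i) (1 / 2) B.center
        rw [abs_le] at hj
        have h3 : r (N i + 1) / β = 1 / 2 * |t i| := by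
          rw [(hrN i).2]
          field_simp
        have h4 := (hrN i).1
        refine ⟨⟨(2 * j + 1 / 2) * t i, r (N i + 1) / β, hpos⟩, ⟨?_, ?_⟩, fun _ ↦ ⟨rfl, ?_, ?_⟩⟩
        · rw [Ball.toSet_subset]
          simp only [h3, hBr, h4]
          constructor <;> linarith [hj.1, hj.2]
        · simp only [hBr]
          exact h1'
        · intro i' hi'
          rw [hinj hi']
          exact ⟨j, rfl⟩
        · exact fun h ↦ absurd rfl (h i)
      · push Not at hn
        refine ⟨⟨B.center, r (n + 1) / β, hpos⟩, ⟨?_, ?_⟩, fun _ ↦ ⟨rfl, ?_, fun _ ↦ rfl⟩⟩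
        · rw [Ball.toSet_subset]
          simp only [hBr]
          constructor <;> linarith [hrp n]
        · simp only [hBr]
          exact h1'
        · exact fun i hi ↦ absurd hi (hn i)
    -- The rule must be satisfiable for every ball, even one that cannot occur in the play.
    · exact ⟨B, ⟨subset_rfl, by linarith [B.radius_pos]⟩, fun h ↦ absurd h hBr⟩
  · have hrad : ∀ n, (B n).radius = r n := by
      intro n
      induction n with
      | zero => rw [hB0, hr0]
      | succ n ih =>
        rw [(hbob n).2, (hP n ih).1]
        field_simp
    intro x hx
    rw [Set.mem_iInter] at hx
    refine htE x fun i ↦ ?_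
    obtain ⟨j, hj⟩ := (hP _ (hrad (N i))).2.1 i rfl
    have hA1 := (hP _ (hrad (N i))).1
    have hc2 := (hP _ (hrad (N i + 1))).2.2 fun k ↦ hne i k
    have hA2 := (hP _ (hrad (N i + 1))).1
    have hs1 := Ball.toSet_subset.1 (hbob (N i)).1
    have hx2 := Ball.mem_toSet.1 ((hbob (N i + 1)).1 (hx (N i + 1 + 1)))
    have h3 : r (N i + 1) / β = 1 / 2 * |t i| := by
      rw [(hrN i).2]
      field_simp
    have h4 : r (N i + 1 + 1) / β ≤ 1 / 2 * r (N i + 1) := by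
      rw [div_le_iff₀ hβ0]
      linarith [(hr (N i + 1)).2]
    rw [hj, hA1, hrad, h3] at hs1
    rw [hc2, hA2] at hx2
    have hpos := hrp (N i + 1)
    -- The bound is strict because the next move is concentric with Bob's ball and has at most half
    -- its radius.
    have h5 : |x - (2 * j + 1 / 2) * t i| < 1 / 2 * |t i| := by
      rw [abs_lt]
      constructor <;> linarith [hs1.1, hs1.2, hx2.1, hx2.2]
    have h6 : |x / t i - (2 * j + 1 / 2)| < 1 / 2 := by
      have h7 : x / t i - (2 * j + 1 / 2) = (x - (2 * j + 1 / 2) * t i) / t i := by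
        rw [sub_div, mul_div_cancel_right₀ _ (ht0 i)]
      rw [h7, abs_div, div_lt_iff₀ (htp i)]
      exact h5
    rw [abs_lt] at h6
    exact ⟨j, by linarith [h6.1], by linarith [h6.2]⟩

/-! ### The set is `1 / 3` winning -/

lemma exists_abs_sub_le_abs_sub_le {c p τ ρ : ℝ} (hτ : |p - c| ≤ τ) (hρ : 0 ≤ ρ) :
    ∃ c', |c' - c| ≤ ρ ∧ |c' - p| ≤ max 0 (τ - ρ) := by
  rw [abs_le] at hτ
  have h0 := le_max_left 0 (τ - ρ)
  have h1 := le_max_right 0 (τ - ρ)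
  simp only [abs_le]
  rcases le_total p (c - ρ) with h | h
  · exact ⟨c - ρ, ⟨by linarith, by linarith⟩, by linarith, by linarith⟩
  rcases le_total p (c + ρ) with h' | h'
  · exact ⟨p, ⟨by linarith, by linarith⟩, by linarith, by linarith⟩
  · exact ⟨c + ρ, ⟨by linarith, by linarith⟩, by linarith, by linarith⟩

/-- Here `u` will be the mismatch between `r₀` and `q`, and `2 ^ v` the error from rounding a turn
to a binary position. -/
lemma exists_abs_mul_two_rpow_sub_le {η : ℝ} (hη : 0 < η) :
    ∃ κ : ℝ, 0 < κ ∧ ∀ u v : ℝ, |u - 3| < κ → |v| < κ → |u * 2 ^ v - 3| ≤ η := by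
  have hcont : ContinuousAt (fun p : ℝ × ℝ ↦ p.1 * (2 : ℝ) ^ p.2) (3, 0) := by
    refine ContinuousAt.mul continuousAt_fst ?_
    exact ContinuousAt.rpow continuousAt_const continuousAt_snd (Or.inl two_ne_zero)
  obtain ⟨κ, hκ, h⟩ := Metric.continuousAt_iff.1 hcont η hη
  refine ⟨κ, hκ, fun u v hu hv ↦ ?_⟩
  have := @h (u, v) (by simpa [Prod.dist_eq, Real.dist_eq] using ⟨hu, hv⟩)
  simp only [Real.dist_eq, Real.rpow_zero, mul_one] at this
  exact this.le

lemma isAlphaWinning_bohrDilates : IsAlphaWinning (1 / 3) bohrDilates := by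
  intro β hβ0 hβ1
  refine aliceWins_of_rule fun B₀ ↦ ?_
  have hr₀ := B₀.radius_pos
  set r₀ := B₀.radius
  obtain ⟨κ, hκ0, hκ⟩ := exists_abs_mul_two_rpow_sub_le (η := β / 6) (by positivity)
  obtain ⟨q, hq1, hq2⟩ := exists_rat_btwn (show 2 * r₀ / (3 + κ) < 2 * r₀ / 3 by gcongr; linarith)
  have hq0 : (0 : ℝ) < q := lt_trans (by positivity) hq1
  have hu : |2 * r₀ / q - 3| < κ := by
    rw [div_lt_iff₀ (by positivity)] at hq1
    rw [lt_div_iff₀ (by positivity)] at hq2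
    rw [abs_lt, lt_sub_iff_add_lt, sub_lt_iff_lt_add, lt_div_iff₀ hq0, div_lt_iff₀ hq0]
    constructor <;> nlinarith
  set lam := Real.logb 2 (3 / β) with hlam
  have hlam0 : 0 < lam := Real.logb_pos one_lt_two (by rw [lt_div_iff₀ hβ0]; linarith)
  have hpow : ∀ n : ℕ, (β / 3) ^ n = (2 : ℝ) ^ (-(n * lam)) := by
    intro n
    rw [mul_comm, ← neg_mul, Real.rpow_mul two_pos.le, Real.rpow_natCast, Real.rpow_neg two_pos.le,
      hlam, Real.rpow_logb two_pos (by norm_num) (by positivity), inv_div]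
  -- The length of the binary intervals of `x / q`, scaled back by `q`, at the position nearest to
  -- turn `n`.
  let τ : ℕ → ℝ := fun n ↦ q * (1 / 2) ^ (round (n * lam)).toNat
  have hτ : ∀ n, 0 < τ n := fun n ↦ by positivity
  let δ := min κ (1 / 4) / (2 * lam)
  have hδ : 0 < δ := by positivity
  -- Alice may shift the centre by `2 / 3 * B.radius`, and the centre of some odd interval is within
  -- `τ n`. At the relevant turns `2 / 3 * B.radius` is almost `τ n`.
  refine ⟨fun n B A ↦ (Odd n → A.center = B.center) ∧
    (Even n → ∃ j : ℤ, |A.center - (2 * j + 3 / 2) * τ n| ≤ max 0 (τ n - 2 / 3 * B.radius)),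
    fun n B ↦ ?_, fun B A hB0 hleg hP hbob ↦ ?_⟩
  · have hB := B.radius_pos
    have legal : ∀ c', |c' - B.center| ≤ 2 / 3 * B.radius →
        Ball.toSet ⟨c', 1 / 3 * B.radius, by positivity⟩ ⊆ B.toSet := by
      intro c' hc'
      rw [abs_le] at hc'
      rw [Ball.toSet_subset]
      constructor <;> simp only <;> linarith [hc'.1, hc'.2]
    rcases Nat.even_or_odd n with hn | hn
    · obtain ⟨j, hj⟩ := exists_int_abs_sub_le (hτ n).ne' (3 / 2) B.center
      rw [abs_of_pos (hτ n)] at hj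
      obtain ⟨c', h1, h2⟩ := exists_abs_sub_le_abs_sub_le hj (ρ := 2 / 3 * B.radius)
        (by positivity)
      exact ⟨⟨c', 1 / 3 * B.radius, by positivity⟩, ⟨legal c' h1, rfl⟩,
        fun h ↦ absurd hn (Nat.not_even_iff_odd.2 h), fun _ ↦ ⟨j, h2⟩⟩
    · exact ⟨⟨B.center, 1 / 3 * B.radius, by positivity⟩, ⟨legal _ (by simp; positivity), rfl⟩,
        fun _ ↦ rfl, fun h ↦ absurd h (Nat.not_even_iff_odd.2 hn)⟩
  · have hrad : ∀ n, (B n).radius = r₀ * (β / 3) ^ n := by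
      intro n
      induction n with
      | zero => rw [hB0, pow_zero, mul_one]
      | succ n ih =>
        rw [(hbob n).2, (hleg n).2, ih]
        ring
    intro x hx
    rw [Set.mem_iInter] at hx
    -- Frequency `1 / (2 * lam)` selects the positions near multiples of `2 * lam`, hence near
    -- even-numbered turns.
    refine mem_bohrDilates_of_odd q (by exact_mod_cast hq0.ne') (γ := 1 / (2 * lam))
      (by positivity) hδ fun m hm ↦ ?_
    obtain ⟨hm0, k, hk⟩ := hm
    have hk1 : |(m : ℝ) - 2 * k * lam| < min κ (1 / 4) := by
      have h1 : (m : ℝ) - 2 * k * lam = (m * (1 / (2 * lam)) - k) * (2 * lam) := by field_simp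
      rw [h1, abs_mul, abs_of_pos (show 0 < 2 * lam by positivity)]
      exact (lt_div_iff₀ (by positivity)).1 hk
    have hk2 := hk1.trans_le (min_le_right _ _)
    have hk3 := hk1.trans_le (min_le_left _ _)
    have hm1 : (1 : ℝ) ≤ m := by exact_mod_cast hm0
    have hk0 : 0 < k := by
      by_contra! h
      have h1 : (k : ℝ) ≤ 0 := by exact_mod_cast h
      rw [abs_lt] at hk2
      nlinarith
    obtain ⟨k', rfl⟩ := Int.eq_ofNat_of_zero_le hk0.le
    simp only [Int.cast_natCast] at hk2 hk3
    set n := 2 * k' with hn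
    have hnr : (n : ℝ) = 2 * k' := by simp [hn]
    rw [← hnr] at hk2 hk3
    have hround : (round (n * lam)).toNat = m := by
      have h1 := abs_sub_round (n * lam)
      have h2 : |((m : ℤ) : ℝ) - (round (n * lam) : ℤ)| < 1 := by
        rw [abs_lt] at hk2 ⊢
        rw [abs_le] at h1
        push_cast
        constructor <;> linarith [hk2.1, hk2.2, h1.1, h1.2]
      have h3 : |(m : ℤ) - round (n * lam)| < 1 := by exact_mod_cast h2
      rw [Int.abs_lt_one_iff] at h3
      lia
    have hτm : τ n = q * (1 / 2) ^ m := by simp only [τ, hround]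
    have hτ0 := hτ n
    obtain ⟨s, hs, hsr⟩ : ∃ s, |s - 3| ≤ β / 6 ∧ (B n).radius = s * τ n / 2 := by
      refine ⟨2 * r₀ / q * 2 ^ ((m : ℝ) - n * lam), hκ _ _ hu hk3, ?_⟩
      rw [hrad, hpow, hτm, sub_eq_add_neg, Real.rpow_add two_pos, Real.rpow_natCast, one_div,
        inv_pow]
      field_simp
    rw [abs_le] at hs
    obtain ⟨j, hj⟩ := (hP n).2 ⟨k', by lia⟩
    have hodd := (hP (n + 1)).1 ⟨k', by lia⟩
    have hj' : |(A n).center - (2 * j + 3 / 2) * τ n| ≤ β / 18 * τ n := by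
      refine hj.trans (max_le (by positivity) ?_)
      rw [hsr]
      nlinarith
    have h1 := Ball.toSet_subset.1 (hbob n).1
    have h2 := Ball.mem_toSet.1 ((hbob (n + 1)).1 (hx (n + 1 + 1)))
    rw [(hleg (n + 1)).2, hodd] at h2
    rw [(hbob n).2, (hleg n).2, hsr] at h1 h2
    have hβτ : 0 < β * τ n := by positivity
    -- Centring error plus Alice's radius, less the gain from the concentric move at turn `n + 1`.
    -- At `s = 3` the gain `β / 3` beats the error `β / 18`, and `|s - 3| ≤ β / 6` is small enough
    -- to preserve this.
    have hsm : β / 18 * τ n + s * τ n / 6 - β * (s * τ n) / 9 < 1 / 2 * τ n := by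
      have : β / 18 + s / 6 - β * s / 9 < 1 / 2 := by nlinarith
      nlinarith
    have h3 : |x - (2 * j + 3 / 2) * τ n| < 1 / 2 * τ n := by
      rw [abs_le] at hj'
      rw [abs_lt]
      constructor <;> linarith [hj'.1, hj'.2, h1.1, h1.2, h2.1, h2.2]
    have h4 : 2 ^ m * (x / q) = x / τ n := by
      rw [hτm, one_div, inv_pow]
      field_simp
    have h5 : |x / τ n - (2 * j + 3 / 2)| < 1 / 2 := by
      have h7 : x / τ n - (2 * j + 3 / 2) = (x - (2 * j + 3 / 2) * τ n) / τ n := by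
        rw [sub_div, mul_div_cancel_right₀ _ hτ0.ne']
      rw [h7, abs_div, abs_of_pos hτ0, div_lt_iff₀ hτ0]
      exact h3
    rw [abs_lt] at h5
    rw [h4]
    exact ⟨j, by linarith [h5.1], by linarith [h5.2]⟩

/-! ### Counting surviving nodes of a tree -/

/-- Positivity of a sequence that loses little at each step, except for bounded factors at the
sparse steps in `Γ`. -/
lemma pos_of_sub_sum_le {θ : ℕ → ℝ} {Γ : ℕ → Prop} {η : ℝ} (hη0 : 0 ≤ η) (hη1 : η ≤ 1 / 80)
    (hθ0 : 0 < θ 0) (hanti : ∀ k, θ (k + 1) ≤ θ k) (hΓ0 : ¬ Γ 0) (hΓ : ∀ k, Γ k → ¬ Γ (k + 1))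
    (h1 : ∀ k, ¬ Γ k → ¬ Γ (k + 1) →
      θ k - ∑ m ∈ Finset.range (k + 1), θ m * η ^ (k - m + 1) ≤ θ (k + 1))
    (h2 : ∀ k, ¬ Γ k → Γ (k + 1) →
      θ k / 8 - ∑ m ∈ Finset.range (k + 1), θ m * η ^ (k - m + 1) -
        ∑ m ∈ Finset.range (k + 2), θ m * η ^ (k + 1 - m + 1) ≤ θ (k + 2)) (k : ℕ) :
    0 < θ k := by
  -- Decay by at most `16` per level keeps the sum of past losses geometric. The constants match: a
  -- sparse step leaves at least `1 / 8 - 2 * η - 3 * η ≥ 1 / 16`.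
  let I : ℕ → Prop := fun k ↦ 0 < θ k ∧ ∀ m ≤ k, θ m ≤ 16 ^ (k - m) * θ k
  have hsum : ∀ k, I k → ∑ m ∈ Finset.range (k + 1), θ m * η ^ (k - m + 1) ≤ 2 * η * θ k := by
    rintro k ⟨hk, hI⟩
    calc ∑ m ∈ Finset.range (k + 1), θ m * η ^ (k - m + 1)
        ≤ ∑ m ∈ Finset.range (k + 1), η * θ k * (1 / 2 : ℝ) ^ (k + 1 - 1 - m) := by
          refine Finset.sum_le_sum fun m hm ↦ ?_
          have hm' := hI m (by simp at hm; lia)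
          calc θ m * η ^ (k - m + 1) ≤ 16 ^ (k - m) * θ k * η ^ (k - m + 1) := by gcongr
            _ = η * θ k * (16 * η) ^ (k - m) := by rw [mul_pow]; ring
            _ ≤ η * θ k * (1 / 2 : ℝ) ^ (k + 1 - 1 - m) := by
              rw [Nat.add_sub_cancel]
              gcongr
              linarith
      _ = η * θ k * ∑ m ∈ Finset.range (k + 1), (1 / 2 : ℝ) ^ m := by
          rw [← Finset.mul_sum, Finset.sum_range_reflect (fun m ↦ (1 / 2 : ℝ) ^ m) (k + 1)]
      _ ≤ η * θ k * 2 := by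
          gcongr
          exact sum_geometric_two_le _
      _ = _ := by ring
  have hI : ∀ k, ¬ Γ k → I k := by
    intro k
    induction k using Nat.strong_induction_on with
    | _ k ih =>
      intro hk
      rcases k with _ | k
      · exact ⟨hθ0, fun m hm ↦ by obtain rfl : m = 0 := by lia
                                  simp⟩
      · by_cases hk' : Γ k
        · rcases k with _ | k
          · exact absurd hk' hΓ0
          have hk'' : ¬ Γ k := fun h ↦ hΓ k h hk'
          have hIk := ih k (by lia) hk''
          have hs := hsum k hIk
          have hs' : ∑ m ∈ Finset.range (k + 2), θ m * η ^ (k + 1 - m + 1) ≤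
              3 * η * θ k := by
            rw [Finset.sum_range_succ]
            have e1 : ∑ m ∈ Finset.range (k + 1), θ m * η ^ (k + 1 - m + 1) =
                η * ∑ m ∈ Finset.range (k + 1), θ m * η ^ (k - m + 1) := by
              rw [Finset.mul_sum]
              refine Finset.sum_congr rfl fun m hm ↦ ?_
              rw [show k + 1 - m = k - m + 1 by simp at hm; lia]
              ring
            rw [e1]
            simp only [Nat.sub_self, zero_add, pow_one]
            have h3 := mul_le_mul_of_nonneg_left hs hη0
            have h4 := mul_le_mul_of_nonneg_right (hanti k) hη0
            have h5 : 0 ≤ η * θ k := mul_nonneg hη0 hIk.1.le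
            nlinarith
          have h3 := h2 k hk'' hk'
          have h4 : θ k ≤ 16 * θ (k + 2) := by nlinarith [hIk.1]
          have hpos : 0 < θ (k + 2) := by linarith [hIk.1]
          refine ⟨hpos, fun m hm ↦ ?_⟩
          rcases Nat.lt_or_ge m (k + 1) with hm' | hm'
          · calc θ m ≤ 16 ^ (k - m) * θ k := hIk.2 m (by lia)
              _ ≤ 16 ^ (k - m) * (16 * θ (k + 2)) := by gcongr
              _ = 16 ^ (k - m + 1) * θ (k + 2) := by ring
              _ ≤ 16 ^ (k + 1 + 1 - m) * θ (k + 2) := by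
                gcongr
                · norm_num
                · lia
          · obtain rfl | rfl : m = k + 1 ∨ m = k + 2 := by lia
            · rw [show k + 1 + 1 - (k + 1) = 1 by lia, pow_one]
              exact (hanti k).trans h4
            · simp
        · have hIk := ih k (by lia) hk'
          have hs := hsum k hIk
          have h3 := h1 k hk' hk
          have h4 : θ k ≤ 16 * θ (k + 1) := by nlinarith [hIk.1]
          have hpos : 0 < θ (k + 1) := by linarith [hIk.1]
          refine ⟨hpos, fun m hm ↦ ?_⟩
          rcases Nat.lt_or_ge m (k + 1) with hm' | hm'
          · calc θ m ≤ 16 ^ (k - m) * θ k := hIk.2 m (by lia)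
              _ ≤ 16 ^ (k - m) * (16 * θ (k + 1)) := by gcongr
              _ = 16 ^ (k + 1 - m) * θ (k + 1) := by
                rw [show k + 1 - m = k - m + 1 by lia]
                ring
          · obtain rfl : m = k + 1 := by lia
            simp
  by_cases hk : Γ k
  · exact (hI (k + 1) (hΓ k hk)).1.trans_le (hanti k)
  · exact (hI k hk).1

/-- The numbers whose quotient by `u` lies in `F`. -/
def descendants (u : ℕ) (F : Finset ℕ) : Finset ℕ :=
  F.biUnion fun b ↦ Finset.Ico (b * u) (b * u + u)

lemma mem_descendants {u : ℕ} (hu : 0 < u) {F : Finset ℕ} {j : ℕ} :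
    j ∈ descendants u F ↔ j / u ∈ F := by
  simp only [descendants, Finset.mem_biUnion, Finset.mem_Ico]
  constructor
  · rintro ⟨b, hb, h1, h2⟩
    rwa [Nat.div_eq_of_lt_le (k := b) h1 (by rw [add_mul, one_mul]; exact h2)]
  · intro h
    exact ⟨j / u, h, Nat.div_mul_le_self j u, Nat.lt_div_mul_add hu⟩

lemma card_filter_descendants (u : ℕ) (F : Finset ℕ) (p : ℕ → Prop) [DecidablePred p] :
    ((descendants u F).filter p).card =
      ∑ b ∈ F, ((Finset.Ico (b * u) (b * u + u)).filter p).card := by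
  rw [descendants, Finset.filter_biUnion, Finset.card_biUnion]
  intro b _ b' _ hbb'
  rw [Function.onFun, Finset.disjoint_left]
  intro j hj hj'
  simp only [Finset.mem_filter, Finset.mem_Ico] at hj hj'
  rcases Nat.lt_or_gt_of_ne hbb' with h | h
  · nlinarith [Nat.mul_le_mul_right u (show b + 1 ≤ b' by lia)]
  · nlinarith [Nat.mul_le_mul_right u (show b' + 1 ≤ b by lia)]

lemma card_descendants (u : ℕ) (F : Finset ℕ) : (descendants u F).card = F.card * u := by
  classical
  have := card_filter_descendants u F fun _ ↦ True
  simpa using this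

open Classical in
/-- In the `R`-ary tree, whose nodes of level `k + 1` below the node `j` of level `k` are the
numbers `i` with `i / R = j`, remove nodes in two ways: few descendants of each surviving node, and
a constant proportion of the nodes at sparse levels. Then nodes survive at all levels. -/
lemma survivors_nonempty {R : ℕ} (hR : 0 < R) {η : ℝ} (hη0 : 0 ≤ η) (hη1 : η ≤ 1 / 80)
    {dead : ℕ → ℕ → ℕ → Prop} {good : ℕ → ℕ → Prop} {Γ : ℕ → Prop} {S : ℕ → Finset ℕ}
    (hS0 : S 0 = {0})
    (hS : ∀ k j, j ∈ S (k + 1) ↔ j / R ∈ S k ∧ good (k + 1) j ∧ ∀ m ≤ k, ¬ dead m k j)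
    (hdead : ∀ m k, m ≤ k → ∀ b ∈ S m,
      (((Finset.Ico (b * R ^ (k - m + 1)) (b * R ^ (k - m + 1) + R ^ (k - m + 1))).filter
        (dead m k)).card : ℝ) ≤ (R * η) ^ (k - m + 1))
    (hΓ0 : ¬ Γ 0) (hΓ : ∀ k, Γ k → ¬ Γ (k + 1)) (hgood1 : ∀ k, ¬ Γ k → ∀ j, good (k + 1) j)
    (hgood2 : ∀ k, Γ (k + 1) → ∀ b : ℕ, ((R * R : ℕ) : ℝ) / 8 ≤
      ((Finset.Ico (b * (R * R)) (b * (R * R) + R * R)).filter (good (k + 2))).card)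
    (k : ℕ) : (S k).Nonempty := by
  have hRr : (0 : ℝ) < R := by exact_mod_cast hR
  have hanc : ∀ d m j, j ∈ S (m + d) → j / R ^ d ∈ S m := by
    intro d
    induction d with
    | zero => simp
    | succ d ih =>
      intro m j hj
      rw [pow_succ', ← Nat.div_div_eq_div_mul]
      exact ih m _ ((hS _ _).1 hj).1
  let kill : ℕ → Finset ℕ := fun k ↦ (descendants R (S k)).filter fun j ↦ ∃ m ≤ k, dead m k j
  have hkill : ∀ k, ((kill k).card : ℝ) ≤
      ∑ m ∈ Finset.range (k + 1), (S m).card * (R * η) ^ (k - m + 1) := by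
    intro k
    have hsub : kill k ⊆ (Finset.range (k + 1)).biUnion fun m ↦
        (descendants (R ^ (k - m + 1)) (S m)).filter (dead m k) := by
      intro j hj
      obtain ⟨hj, m, hm, hd⟩ := Finset.mem_filter.1 hj
      rw [mem_descendants hR] at hj
      refine Finset.mem_biUnion.2 ⟨m, by simp; lia, Finset.mem_filter.2 ⟨?_, hd⟩⟩
      rw [mem_descendants (by positivity), pow_succ', ← Nat.div_div_eq_div_mul]
      exact hanc (k - m) m _ (by rwa [Nat.add_sub_cancel' hm])
    calc ((kill k).card : ℝ)
        ≤ ∑ m ∈ Finset.range (k + 1),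
          (((descendants (R ^ (k - m + 1)) (S m)).filter (dead m k)).card : ℝ) := by
          exact_mod_cast (Finset.card_le_card hsub).trans Finset.card_biUnion_le
      _ ≤ _ := by
          refine Finset.sum_le_sum fun m hm ↦ ?_
          rw [card_filter_descendants]
          push_cast
          rw [← nsmul_eq_mul]
          exact Finset.sum_le_card_nsmul _ _ _ fun b hb ↦
            hdead m k (by simp at hm; lia) b hb
  -- The proportion of surviving nodes at level `k`.
  let θ : ℕ → ℝ := fun k ↦ (S k).card / R ^ k
  have hkill' : ∀ k, ((kill k).card : ℝ) / R ^ (k + 1) ≤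
      ∑ m ∈ Finset.range (k + 1), θ m * η ^ (k - m + 1) := by
    intro k
    rw [div_le_iff₀ (by positivity), Finset.sum_mul]
    refine (hkill k).trans (Finset.sum_le_sum fun m hm ↦ le_of_eq ?_)
    have : k + 1 = m + (k - m + 1) := by simp at hm; lia
    simp only [θ]
    conv_rhs => rw [this, pow_add (R : ℝ) m]
    rw [mul_pow]
    field_simp
  suffices 0 < θ k by
    rw [← Finset.card_pos]
    by_contra! h
    have h0 : (S k).card = 0 := by lia
    simp [θ, h0] at this
  refine pos_of_sub_sum_le (Γ := Γ) hη0 hη1 (by simp [θ, hS0]) (fun k ↦ ?_) hΓ0 hΓ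
    (fun k hk _ ↦ ?_) (fun k hk hk1 ↦ ?_) k
  · have hsub : S (k + 1) ⊆ descendants R (S k) := fun j hj ↦
      (mem_descendants hR).2 ((hS k j).1 hj).1
    have hc : ((S (k + 1)).card : ℝ) ≤ (S k).card * R := by
      exact_mod_cast (Finset.card_le_card hsub).trans (card_descendants _ _).le
    simp only [θ]
    rw [div_le_div_iff₀ (by positivity) (by positivity), pow_succ]
    nlinarith [show (0 : ℝ) < R ^ k by positivity]
  · have hsub : descendants R (S k) ⊆ S (k + 1) ∪ kill k := by
      intro j hj
      by_cases hd : ∃ m ≤ k, dead m k j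
      · exact Finset.mem_union_right _ (Finset.mem_filter.2 ⟨hj, hd⟩)
      · push Not at hd
        exact Finset.mem_union_left _ ((hS k j).2 ⟨(mem_descendants hR).1 hj, hgood1 k hk j, hd⟩)
    have hc : ((S k).card * R : ℝ) ≤ (S (k + 1)).card + (kill k).card := by
      have := (Finset.card_le_card hsub).trans (Finset.card_union_le _ _)
      rw [card_descendants] at this
      exact_mod_cast this
    have h1 : θ k ≤ θ (k + 1) + (kill k).card / R ^ (k + 1) := by
      simp only [θ]
      rw [← add_div, div_le_div_iff₀ (by positivity) (by positivity), pow_succ]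
      nlinarith [show (0 : ℝ) < R ^ k by positivity]
    linarith [hkill' k]
  -- Two generations are treated at once: a single node of level `k + 1` may have no good children,
  -- but each node of level `k` has many good grandchildren.
  · have hsub : (descendants (R * R) (S k)).filter (good (k + 2)) ⊆
        S (k + 2) ∪ (descendants R (kill k) ∪ kill (k + 1)) := by
      intro j hj
      obtain ⟨hj, hg⟩ := Finset.mem_filter.1 hj
      rw [mem_descendants (by positivity), ← Nat.div_div_eq_div_mul] at hj
      by_cases hd : ∃ m ≤ k, dead m k (j / R)
      · refine Finset.mem_union_right _ (Finset.mem_union_left _ ((mem_descendants hR).2 ?_))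
        exact Finset.mem_filter.2 ⟨(mem_descendants hR).2 hj, hd⟩
      · push Not at hd
        have hj1 : j / R ∈ S (k + 1) := (hS k _).2 ⟨hj, hgood1 k hk _, hd⟩
        by_cases hd' : ∃ m ≤ k + 1, dead m (k + 1) j
        · exact Finset.mem_union_right _ (Finset.mem_union_right _
            (Finset.mem_filter.2 ⟨(mem_descendants hR).2 hj1, hd'⟩))
        · push Not at hd'
          exact Finset.mem_union_left _ ((hS (k + 1) j).2 ⟨hj1, hg, hd'⟩)
    have hc : ((S k).card * ((R * R : ℕ) / 8) : ℝ) ≤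
        (S (k + 2)).card + ((kill k).card * R + (kill (k + 1)).card) := by
      have h1 := (Finset.card_le_card hsub).trans ((Finset.card_union_le _ _).trans
        (Nat.add_le_add_left (Finset.card_union_le _ _) _))
      rw [card_descendants, card_filter_descendants] at h1
      have h2 := Finset.card_nsmul_le_sum (S k) (fun b ↦
        (((Finset.Ico (b * (R * R)) (b * (R * R) + R * R)).filter (good (k + 2))).card : ℝ)) _
        fun b _ ↦ hgood2 k hk1 b
      rw [nsmul_eq_mul] at h2
      refine h2.trans ?_
      exact_mod_cast h1
    have h1 : θ k / 8 ≤ θ (k + 2) + ((kill k).card / R ^ (k + 1) +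
        (kill (k + 1)).card / R ^ (k + 1 + 1)) := by
      have e1 : θ k / 8 = (S k).card * ((R * R : ℕ) / 8) / R ^ (k + 2) := by
        simp only [θ]
        push_cast
        field_simp
        ring
      have e2 : θ (k + 2) + ((kill k).card / R ^ (k + 1) + (kill (k + 1)).card / R ^ (k + 1 + 1)) =
          ((S (k + 2)).card + ((kill k).card * R + (kill (k + 1)).card)) / R ^ (k + 2) := by
        simp only [θ]
        field_simp
        ring
      rw [e1, e2]
      gcongr
    linarith [hkill' k, hkill' (k + 1)]

/-! ### Intervals of length one inside the even gaps of an arithmetic progression -/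

-- About `L / (2 * τ)` full periods fit, and each gap of length `τ` holds at least `⌊τ⌋₊ - 2 ≥ τ / 2
-- - 1 / 2`, in fact at least `τ / 2`, unit intervals since `τ ≥ 6`. At most two periods are lost to
-- the ends and rounding, a quarter of `L` at worst, which leaves `3 / 16` of `L`.
open Classical in
lemma card_filter_even_gap (a L : ℕ) {τ : ℝ} (hτ : 6 ≤ τ) (hL : 16 * τ ≤ L) (θ : ℝ) :
    (L : ℝ) / 8 ≤ ((Finset.Ico a (a + L)).filter fun j : ℕ ↦
      ∃ l : ℤ, (2 * l + θ) * τ < j ∧ (j : ℝ) + 1 < (2 * l + 1 + θ) * τ).card := by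
  have hτ0 : 0 < τ := by linarith
  set l₀ := ⌈(a / τ - θ) / 2⌉ with hl₀
  set P := ⌊(L : ℝ) / (2 * τ)⌋₊ - 1 with hP
  set D := ⌊τ⌋₊ - 2 with hD
  have hP1 : (P : ℝ) * (2 * τ) + 2 * τ ≤ L ∧ (L : ℝ) ≤ P * (2 * τ) + 4 * τ := by
    have h1 : 8 ≤ ⌊(L : ℝ) / (2 * τ)⌋₊ := by
      rw [Nat.le_floor_iff (by positivity), le_div_iff₀ (by positivity)]
      push_cast
      linarith
    have h2 : (P : ℝ) = ⌊(L : ℝ) / (2 * τ)⌋₊ - 1 := by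
      rw [hP, Nat.cast_sub (by lia), Nat.cast_one]
    have h3 := Nat.floor_le (show 0 ≤ (L : ℝ) / (2 * τ) by positivity)
    have h4 := Nat.lt_floor_add_one ((L : ℝ) / (2 * τ))
    rw [le_div_iff₀ (by positivity)] at h3
    rw [div_lt_iff₀ (by positivity)] at h4
    rw [h2]
    constructor <;> linarith
  have hD1 : (D : ℝ) + 2 ≤ τ ∧ τ ≤ D + 3 := by
    have h1 : 6 ≤ ⌊τ⌋₊ := by rwa [Nat.le_floor_iff hτ0.le]
    have h2 : (D : ℝ) = ⌊τ⌋₊ - 2 := by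
      rw [hD, Nat.cast_sub (by lia)]
      norm_num
    have h3 := Nat.floor_le hτ0.le
    have h4 := Nat.lt_floor_add_one τ
    rw [h2]
    constructor <;> linarith
  let s : ℕ → ℝ := fun i ↦ (2 * (l₀ + i) + θ) * τ
  have hs : ∀ i, (a : ℝ) + i * (2 * τ) ≤ s i ∧ s i < a + 2 * τ + i * (2 * τ) := by
    intro i
    have h1 := Int.le_ceil ((a / τ - θ) / 2)
    have h2 := Int.ceil_lt_add_one ((a / τ - θ) / 2)
    rw [← hl₀] at h1 h2
    have h3 : (a : ℝ) / τ ≤ 2 * l₀ + θ := by linarith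
    have h4 : 2 * (l₀ : ℝ) + θ - 2 < a / τ := by linarith
    rw [div_le_iff₀ hτ0] at h3
    rw [lt_div_iff₀ hτ0] at h4
    simp only [s]
    constructor <;> linarith
  let f : ℕ × ℕ → ℕ := fun p ↦ ⌊s p.1⌋₊ + 1 + p.2
  have hf : ∀ i d, d < D → s i < f (i, d) ∧ (f (i, d) : ℝ) + 1 < s i + τ := by
    intro i d hd
    have hs0 : 0 ≤ s i := le_trans (by positivity) (hs i).1
    have h1 := Nat.floor_le hs0
    have h2 := Nat.lt_floor_add_one (s i)
    have h3 : (d : ℝ) + 1 ≤ D := by exact_mod_cast hd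
    have h4 : (0 : ℝ) ≤ d := by positivity
    simp only [f]
    push_cast
    constructor <;> linarith [hD1.1]
  have hcard : P * D ≤ ((Finset.Ico a (a + L)).filter fun j : ℕ ↦
      ∃ l : ℤ, (2 * l + θ) * τ < j ∧ (j : ℝ) + 1 < (2 * l + 1 + θ) * τ).card := by
    have h0 : P * D = (Finset.range P ×ˢ Finset.range D).card := by simp
    rw [h0]
    refine Finset.card_le_card_of_injOn f ?_ ?_
    · rintro ⟨i, d⟩ hid
      simp only [Finset.coe_product, Finset.coe_range, Set.mem_prod, Set.mem_Iio] at hid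
      obtain ⟨h1, h2⟩ := hf i d hid.2
      have h3 := hs i
      have h4 : (i : ℝ) + 1 ≤ P := by exact_mod_cast hid.1
      have h5 : ((i : ℝ) + 1) * (2 * τ) ≤ P * (2 * τ) := by gcongr
      have h6 : (0 : ℝ) ≤ i * (2 * τ) := by positivity
      simp only [Finset.coe_filter, Finset.mem_Ico, Set.mem_ofPred_eq]
      refine ⟨⟨?_, ?_⟩, l₀ + i, ?_, ?_⟩
      · have : (a : ℝ) ≤ f (i, d) := by linarith [h3.1]
        exact_mod_cast this
      · have : (f (i, d) : ℝ) < a + L := by linarith [h3.2, hP1.1]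
        exact_mod_cast this
      · push_cast
        exact h1
      · push_cast
        simp only [s] at h2
        linarith
    · rintro ⟨i, d⟩ hid ⟨i', d'⟩ hid' heq
      simp only [Finset.coe_product, Finset.coe_range, Set.mem_prod, Set.mem_Iio] at hid hid'
      have key : ∀ i d i' d', d < D → d' < D → f (i, d) = f (i', d') → i ≤ i' := by
        intro i d i' d' hd hd' heq
        by_contra! h
        have h1 := (hf i d hd).1
        have h2 := (hf i' d' hd').2
        rw [heq] at h1
        have h3 : (i' : ℝ) + 1 ≤ i := by exact_mod_cast h
        simp only [s] at h1 h2
        nlinarith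
      obtain rfl : i = i' := le_antisymm (key _ _ _ _ hid.2 hid'.2 heq)
        (key _ _ _ _ hid'.2 hid.2 heq.symm)
      simp only [f] at heq
      simp only [Prod.mk.injEq, true_and]
      lia
  have h1 : (P : ℝ) * D ≤ ((Finset.Ico a (a + L)).filter fun j : ℕ ↦
      ∃ l : ℤ, (2 * l + θ) * τ < j ∧ (j : ℝ) + 1 < (2 * l + 1 + θ) * τ).card := by
    exact_mod_cast hcard
  refine le_trans ?_ h1
  have h2 : τ / 2 ≤ D := by linarith [hD1.2]
  have h3 : (P : ℝ) * (τ / 2) ≤ P * D := by gcongr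
  linarith [hP1.2]

/-! ### The set is not Cantor winning -/

/-- The `j`-th interval of length `R ^ (-k)`. -/
noncomputable def node (R : ℕ+) (k j : ℕ) : Ball where
  center := (2 * (j : ℝ) + 1) / (2 * ((R : ℕ) : ℝ) ^ k)
  radius := 1 / (2 * ((R : ℕ) : ℝ) ^ k)
  radius_pos := by
    have : (0 : ℝ) < (R : ℕ) := by exact_mod_cast R.pos
    positivity

lemma pnat_cast_pos (R : ℕ+) : (0 : ℝ) < (R : ℕ) := by exact_mod_cast R.pos

lemma mem_node {R : ℕ+} {k j : ℕ} {x : ℝ} : x ∈ (node R k j).toSet ↔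
    (j : ℝ) ≤ x * ((R : ℕ) : ℝ) ^ k ∧ x * ((R : ℕ) : ℝ) ^ k ≤ j + 1 := by
  have hR := pnat_cast_pos R
  rw [Ball.mem_toSet]
  simp only [node]
  rw [← sub_div, ← add_div, div_le_iff₀ (by positivity), le_div_iff₀ (by positivity)]
  constructor <;> rintro ⟨h1, h2⟩ <;> constructor <;> linarith

lemma node_injective (R : ℕ+) (k : ℕ) : Function.Injective (node R k) := by
  intro i j h
  have hR := pnat_cast_pos R
  have h1 := congrArg Ball.center h
  simp only [node] at h1
  rw [div_left_inj' (by positivity)] at h1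
  have : (i : ℝ) = j := by linarith
  exact_mod_cast this

lemma node_mem_splitting (R : ℕ+) (k j : ℕ) :
    node R (k + 1) j ∈ (node R k (j / (R : ℕ))).splitting R := by
  have hR := pnat_cast_pos R
  refine ⟨⟨j % (R : ℕ), Nat.mod_lt _ R.pos⟩, ?_⟩
  have h : ((j : ℕ) : ℝ) = (R : ℕ) * (j / (R : ℕ) : ℕ) + (j % (R : ℕ) : ℕ) := by
    exact_mod_cast (Nat.div_add_mod j R).symm
  ext
  · simp only [Ball.piece, node]
    rw [h, pow_succ]
    field_simp
    ring
  · simp only [Ball.piece, node]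
    rw [pow_succ]
    field_simp

lemma node_subset (R : ℕ+) (k d j : ℕ) :
    (node R (k + d) j).toSet ⊆ (node R k (j / (R : ℕ) ^ d)).toSet := by
  have hR := pnat_cast_pos R
  intro x hx
  rw [mem_node] at hx ⊢
  have h1 := Nat.div_mul_le_self j ((R : ℕ) ^ d)
  have h2 : j + 1 ≤ (j / (R : ℕ) ^ d + 1) * (R : ℕ) ^ d := by
    rw [add_mul, one_mul]
    exact Nat.lt_div_mul_add (pow_pos R.pos d)
  generalize j / (R : ℕ) ^ d = b at h1 h2
  have h3 : (b : ℝ) * ((R : ℕ) : ℝ) ^ d ≤ j := by exact_mod_cast h1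
  have h4 : (j : ℝ) + 1 ≤ (b + 1) * ((R : ℕ) : ℝ) ^ d := by exact_mod_cast h2
  rw [pow_add, ← mul_assoc] at hx
  have hd : (0 : ℝ) < ((R : ℕ) : ℝ) ^ d := by positivity
  exact ⟨le_of_mul_le_mul_right (h3.trans hx.1) hd, le_of_mul_le_mul_right (hx.2.trans h4) hd⟩

open Classical in
/-- A constant proportion of the descendants of a node, two generations later, is contained in the
set of numbers with digit `0` at an intermediate scale. -/
lemma card_filter_node_even {s : ℕ} (hs : 16 ≤ s) {R : ℕ+} (hR : (R : ℕ) = s ^ 2) {k : ℕ} {t : ℝ}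
    (ht : t ≠ 0) (ht1 : 1 ≤ s * |t| * ((R : ℕ) : ℝ) ^ (k + 1))
    (ht2 : |t| * ((R : ℕ) : ℝ) ^ (k + 1) ≤ s) (b : ℕ) :
    ((R * R : ℕ) : ℝ) / 8 ≤ ((Finset.Ico (b * ((R : ℕ) * R)) (b * (R * R) + R * R)).filter
      fun j ↦ ∃ l : ℤ, ∀ x ∈ (node R (k + 2) j).toSet,
        2 * (l : ℝ) < x / t ∧ x / t < 2 * l + 1).card := by
  have hs' : (16 : ℝ) ≤ s := by exact_mod_cast hs
  have hRr : ((R : ℕ) : ℝ) = (s : ℝ) ^ 2 := by exact_mod_cast hR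
  have hR0 := pnat_cast_pos R
  have htp : 0 < |t| := abs_pos.2 ht
  set τ := |t| * ((R : ℕ) : ℝ) ^ (k + 2) with hτ
  have hτ' : τ = |t| * ((R : ℕ) : ℝ) ^ (k + 1) * s ^ 2 := by
    rw [hτ, ← hRr]
    ring
  have hτ1 : 6 ≤ τ := by
    rw [hτ']
    nlinarith
  have hτ2 : 16 * τ ≤ ((R * R : ℕ) : ℝ) := by
    have e : ((R * R : ℕ) : ℝ) = s * (s * s ^ 2) := by
      push_cast
      rw [hRr]
      ring
    rw [hτ', e]
    gcongr
  have hτ0 : 0 < τ := by linarith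
  have hmem : ∀ {j : ℕ} {x u v : ℝ}, u * τ < j → (j : ℝ) + 1 < v * τ →
      x ∈ (node R (k + 2) j).toSet → u < x / |t| ∧ x / |t| < v := by
    intro j x u v hu hv hx
    rw [mem_node] at hx
    have hx' : x * ((R : ℕ) : ℝ) ^ (k + 2) = x / |t| * τ := by
      rw [hτ]
      field_simp
    rw [hx'] at hx
    exact ⟨lt_of_mul_lt_mul_right (hu.trans_le hx.1) hτ0.le,
      lt_of_mul_lt_mul_right (hx.2.trans_lt hv) hτ0.le⟩
  -- For negative `t` the reflection turns even intervals of `x / t` into odd ones of `x / |t|`,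
  -- whence the offset `1` instead of `0`.
  rcases lt_or_gt_of_ne ht with h | h
  · refine (card_filter_even_gap (b * (R * R)) (R * R) hτ1 hτ2 1).trans ?_
    refine Nat.cast_le.2 (Finset.card_le_card (Finset.monotone_filter_right _ ?_))
    rintro j - ⟨l, h1, h2⟩
    refine ⟨-l - 1, fun x hx ↦ ?_⟩
    have h3 := hmem h1 h2 hx
    rw [abs_of_neg h, div_neg] at h3
    push_cast
    constructor <;> linarith [h3.1, h3.2]
  · refine (card_filter_even_gap (b * (R * R)) (R * R) hτ1 hτ2 0).trans ?_
    refine Nat.cast_le.2 (Finset.card_le_card (Finset.monotone_filter_right _ ?_))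
    rintro j - ⟨l, h1, h2⟩
    refine ⟨l, fun x hx ↦ ?_⟩
    have h3 := hmem h1 h2 hx
    rw [abs_of_pos h] at h3
    constructor <;> linarith [h3.1, h3.2]

/-- Sparse scales can be assigned to levels of the tree that are pairwise non-adjacent. -/
lemma exists_levels {s : ℕ} (hs : 16 ≤ s) {R : ℕ} (hR : R = s ^ 2) {t : ℕ → ℝ}
    (ht0 : ∀ i, t i ≠ 0) (ht1 : |t 0| ≤ (1 / (R : ℝ)) ^ 3)
    (ht2 : ∀ i, |t (i + 1)| ≤ (1 / (R : ℝ)) ^ 3 * |t i|) :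
    ∃ N : ℕ → ℕ, (∀ i, N i ≠ 0) ∧ Function.Injective N ∧ (∀ i j, N j ≠ N i + 1) ∧
      ∀ i, 1 ≤ s * |t i| * (R : ℝ) ^ N i ∧ |t i| * (R : ℝ) ^ N i ≤ s := by
  have hs' : (16 : ℝ) ≤ s := by exact_mod_cast hs
  have hRr : (R : ℝ) = (s : ℝ) ^ 2 := by exact_mod_cast hR
  have hs0 : (0 : ℝ) < s := by linarith
  have hR1 : (1 : ℝ) < R := by rw [hRr]; nlinarith
  have hR0 : (0 : ℝ) < R := by linarith
  have hinv : 1 / (R : ℝ) < 1 := by rw [div_lt_one hR0]; exact hR1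
  have hinv0 : 0 < 1 / (R : ℝ) := by positivity
  have htp : ∀ i, 0 < |t i| := fun i ↦ abs_pos.2 (ht0 i)
  have ht3 : ∀ i, |t i| ≤ 1 / R := by
    intro i
    induction i with
    | zero => exact ht1.trans (pow_le_of_le_one hinv0.le hinv.le (by norm_num))
    | succ i ih =>
      exact (ht2 i).trans ((mul_le_of_le_one_left (htp i).le
        (pow_le_one₀ hinv0.le hinv.le)).trans ih)
  have hN : ∀ i, ∃ n : ℕ, n ≠ 0 ∧ (1 / (R : ℝ)) ^ n ≤ s * |t i| ∧
      |t i| ≤ s * (1 / (R : ℝ)) ^ n := by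
    intro i
    have h1 : s * |t i| ≤ 1 := by
      have := ht3 i
      rw [le_div_iff₀ hR0, hRr] at this
      nlinarith [htp i]
    obtain ⟨n, hn1, hn2⟩ := exists_nat_pow_near_of_lt_one (mul_pos hs0 (htp i)) h1 hinv0 hinv
    refine ⟨n + 1, by simp, hn1.le, ?_⟩
    have e : (s : ℝ) * (1 / (R : ℝ)) ^ (n + 1) = (1 / R) ^ n / s := by
      rw [pow_succ, hRr]
      field_simp
    rw [e, le_div_iff₀ hs0]
    linarith
  choose N hN0 hN1 hN2 using hN
  -- One of the three factors `1 / R` is absorbed by the two roundings by `s`, as `s ^ 2 = R`.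
  have hgap : ∀ i, N i + 2 ≤ N (i + 1) := by
    intro i
    have h1 : (1 / (R : ℝ)) ^ N (i + 1) ≤ (1 / (R : ℝ)) ^ (N i + 2) := by
      calc (1 / (R : ℝ)) ^ N (i + 1) ≤ s * |t (i + 1)| := hN1 _
        _ ≤ s * ((1 / (R : ℝ)) ^ 3 * (s * (1 / (R : ℝ)) ^ N i)) := by
          gcongr
          exact (ht2 i).trans (by gcongr; exact hN2 i)
        _ = _ := by
          rw [pow_add, hRr]
          field_simp
    rwa [pow_le_pow_iff_right_of_lt_one₀ hinv0 hinv] at h1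
  have hmono : StrictMono N := strictMono_nat_of_lt_succ fun i ↦ by have := hgap i; lia
  refine ⟨N, hN0, hmono.injective, fun i j hij ↦ ?_, fun i ↦ ⟨?_, ?_⟩⟩
  · have h1 : i < j := hmono.lt_iff_lt.1 (by lia)
    have h2 := hmono.monotone (show i + 1 ≤ j from h1)
    have h3 := hgap i
    lia
  · have := hN1 i
    rwa [one_div, inv_pow, inv_le_iff_one_le_mul₀ (by positivity)] at this
  · have := hN2 i
    rwa [one_div, inv_pow, ← div_eq_mul_inv, le_div_iff₀ (by positivity)] at this

open Classical in
/-- A Cantor set in `[0, 1]` with few removed balls contains numbers with digit `0` at all of a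
given sequence of sparse scales. -/
lemma exists_mem_cantorSet {s : ℕ} (hs : 16 ≤ s) {R : ℕ+} (hR : (R : ℕ) = s ^ 2) {η : ℝ}
    (hη0 : 0 ≤ η) (hη1 : η ≤ 1 / 80) {r : ℕ → ℕ → ℝ} {K : Set ℝ}
    (hK : IsCantorSet (node R 0 0) R r K)
    (hr : ∀ m n : ℕ, m ≤ n → r m n ≤ (((R : ℕ) : ℝ) * η) ^ (n - m + 1)) {t : ℕ → ℝ}
    (ht0 : ∀ i, t i ≠ 0) (ht1 : |t 0| ≤ (1 / ((R : ℕ) : ℝ)) ^ 3)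
    (ht2 : ∀ i, |t (i + 1)| ≤ (1 / ((R : ℕ) : ℝ)) ^ 3 * |t i|) :
    ∃ x ∈ K, ∀ i, ∃ j : ℤ, 2 * (j : ℝ) < x / t i ∧ x / t i < 2 * (j : ℝ) + 1 := by
  obtain ⟨ℬ, 𝒜, hℬ0, hℬ, -, h𝒜, rfl⟩ := hK
  obtain ⟨N, hN0, hNinj, hNgap, hN⟩ := exists_levels hs hR ht0 ht1 ht2
  let even : ℕ → ℕ → ℕ → Prop := fun i k j ↦ ∃ l : ℤ, ∀ x ∈ (node R k j).toSet,
    2 * (l : ℝ) < x / t i ∧ x / t i < 2 * (l : ℝ) + 1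
  let good : ℕ → ℕ → Prop := fun k j ↦ ∀ i, N i + 1 = k → even i k j
  let dead : ℕ → ℕ → ℕ → Prop := fun m k j ↦ node R (k + 1) j ∈ 𝒜 m k
  let S : ℕ → Finset ℕ := fun k ↦ Nat.rec {0} (fun k F ↦ (descendants R F).filter
    fun j ↦ good (k + 1) j ∧ ∀ m ≤ k, ¬ dead m k j) k
  have hS : ∀ k j, j ∈ S (k + 1) ↔
      j / (R : ℕ) ∈ S k ∧ good (k + 1) j ∧ ∀ m ≤ k, ¬ dead m k j := by
    intro k j
    change j ∈ (descendants R (S k)).filter _ ↔ _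
    rw [Finset.mem_filter, mem_descendants R.pos]
  have hSℬ : ∀ k, ∀ j ∈ S k, node R k j ∈ ℬ k := by
    intro k
    induction k with
    | zero =>
      intro j hj
      obtain rfl : j = 0 := by simpa [S] using hj
      rw [hℬ0]
      exact Set.mem_singleton _
    | succ k ih =>
      intro j hj
      obtain ⟨h1, -, h2⟩ := (hS k j).1 hj
      rw [hℬ]
      refine ⟨Set.mem_biUnion (ih _ h1) (node_mem_splitting R k j), ?_⟩
      simp only [Set.mem_iUnion, Set.mem_Iic, not_exists]
      exact h2
  have hne : ∀ k, (S k).Nonempty := by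
    refine survivors_nonempty (Γ := fun n ↦ ∃ i, N i = n) R.pos hη0 hη1 rfl hS
      (fun m k hmk b hb ↦ ?_) (fun ⟨i, hi⟩ ↦ hN0 i hi) (fun k ⟨i, hi⟩ ⟨j, hj⟩ ↦
        hNgap i j (by rw [hj, hi])) (fun k hk j i hi ↦ absurd ⟨i, by lia⟩ hk)
      (fun k ⟨i, hi⟩ b ↦ ?_)
    · obtain ⟨hfin, hcard⟩ := h𝒜 m k hmk _ (hSℬ m b hb)
      refine le_trans ?_ (hcard.trans (hr m k hmk))
      rw [← Finset.card_image_of_injective _ (node_injective R (k + 1)), ← Set.ncard_coe_finset]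
      refine Nat.cast_le.2 (Set.ncard_le_ncard ?_ hfin)
      intro A hA
      simp only [Finset.coe_image, Finset.coe_filter, Finset.mem_Ico, Set.mem_image,
        Set.mem_ofPred_eq] at hA
      obtain ⟨j, ⟨⟨h1, h2⟩, h3⟩, rfl⟩ := hA
      refine ⟨h3, ?_⟩
      have h4 : j / (R : ℕ) ^ (k - m + 1) = b :=
        Nat.div_eq_of_lt_le h1 (by rw [add_mul, one_mul]; exact h2)
      have h5 := node_subset R m (k - m + 1) j
      rw [h4, show m + (k - m + 1) = k + 1 by lia] at h5
      exact h5
    · have h1 := hN i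
      rw [hi] at h1
      refine (card_filter_node_even hs hR (ht0 i) h1.1 h1.2 b).trans ?_
      refine Nat.cast_le.2 (Finset.card_le_card (Finset.monotone_filter_right _ ?_))
      intro j _ hj i' hi'
      obtain rfl : i' = i := hNinj (by lia)
      exact hj
  let C : ℕ → Set ℝ := fun k ↦ ⋃ j ∈ S k, (node R k j).toSet
  have hcomp : ∀ k, IsCompact (C k) := fun k ↦
    (S k).isCompact_biUnion fun j _ ↦ isCompact_closedBall _ _
  obtain ⟨x, hx⟩ : (⋂ k, C k).Nonempty := by
    refine IsCompact.nonempty_iInter_of_sequence_nonempty_isCompact_isClosed C (fun k x hx ↦ ?_)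
      (fun k ↦ ?_) (hcomp 0) fun k ↦ (hcomp k).isClosed
    · simp only [C, Set.mem_iUnion] at hx ⊢
      obtain ⟨j, hj, hx⟩ := hx
      refine ⟨j / (R : ℕ), ((hS k j).1 hj).1, ?_⟩
      simpa using node_subset R k 1 j hx
    · obtain ⟨j, hj⟩ := hne k
      refine ⟨(node R k j).center, Set.mem_biUnion hj ?_⟩
      exact Metric.mem_closedBall_self (node R k j).radius_pos.le
  simp only [C, Set.mem_iInter, Set.mem_iUnion] at hx
  refine ⟨x, ?_, fun i ↦ ?_⟩
  · rw [Set.mem_iInter]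
    intro k
    obtain ⟨j, hj, hxj⟩ := hx k
    exact Set.mem_biUnion (hSℬ k j hj) hxj
  · obtain ⟨j, hj, hxj⟩ := hx (N i + 1)
    obtain ⟨l, hl⟩ := ((hS _ j).1 hj).2.1 i rfl
    exact ⟨l, hl x hxj⟩

lemma not_isCantorWinning_bohrDilates : ¬ IsCantorWinning bohrDilates := by
  rintro ⟨ε₀, hε₀, -, h⟩
  obtain ⟨R₀, hR₀⟩ := h (node 1 0 0) (ε₀ / 2) (by positivity) (by linarith)
  obtain ⟨s, hs16, hsR, hsε⟩ : ∃ s : ℕ, 16 ≤ s ∧ (R₀ : ℕ) ≤ s ∧ 80 ≤ (s : ℝ) ^ (ε₀ / 2) := by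
    have h1 := (tendsto_rpow_atTop (show 0 < ε₀ / 2 by positivity)).comp
      (tendsto_natCast_atTop_atTop (R := ℝ))
    obtain ⟨s, ⟨h2, h3⟩, h4⟩ := (((eventually_ge_atTop 16).and (eventually_ge_atTop (R₀ : ℕ))).and
      (h1.eventually_ge_atTop 80)).exists
    exact ⟨s, h2, h3, h4⟩
  -- A square, so that each scale is within the integer factor `√R = s` of a power of `1 / R`.
  let R : ℕ+ := ⟨s ^ 2, by positivity⟩
  have hR : (R : ℕ) = s ^ 2 := rfl
  have hR0 := pnat_cast_pos R
  have hsR' : s ≤ (R : ℕ) := by rw [hR]; nlinarith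
  obtain ⟨r, K, hK, hKE, hr⟩ := hR₀ R (by rw [← PNat.coe_le_coe]; exact hsR.trans hsR')
  have hη1 : ((R : ℕ) : ℝ) ^ (-(ε₀ / 2)) ≤ 1 / 80 := by
    rw [Real.rpow_neg hR0.le, one_div]
    have h1 : (s : ℝ) ^ (ε₀ / 2) ≤ ((R : ℕ) : ℝ) ^ (ε₀ / 2) :=
      Real.rpow_le_rpow (by positivity) (by exact_mod_cast hsR') (by positivity)
    gcongr
    linarith
  -- The initial ball `[0, 1]` has to be named before `R` is known.
  have hnode : node 1 0 0 = node R 0 0 := by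
    ext <;> simp [node]
  rw [hnode] at hK
  obtain ⟨t, ht0, ht1, ht2, htE⟩ := exists_sparse_scales
    (show 0 < (1 / ((R : ℕ) : ℝ)) ^ 3 by positivity)
  have hr' : ∀ m n : ℕ, m ≤ n →
      r m n ≤ (((R : ℕ) : ℝ) * ((R : ℕ) : ℝ) ^ (-(ε₀ / 2))) ^ (n - m + 1) := by
    intro m n hmn
    refine (hr m n hmn).2.trans (le_of_eq ?_)
    rw [mul_comm, Real.rpow_mul hR0.le, Real.rpow_natCast, sub_eq_add_neg, Real.rpow_add hR0,
      Real.rpow_one]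
  obtain ⟨x, hxK, hx⟩ := exists_mem_cantorSet hs16 hR (by positivity) hη1 hK hr' ht0 ht1 ht2
  exact htE x hx (hKE hxK)

end SchmidtCantor

theorem mainTheorem7 :
    SchmidtCantor.IsWinning SchmidtCantor.bohrDilates ∧
    SchmidtCantor.IsAlphaWinning (1 / 3) SchmidtCantor.bohrDilates ∧
    SchmidtCantor.IsWeakAlphaWinning (1 / 3) SchmidtCantor.bohrDilatesᶜ ∧
    ¬ SchmidtCantor.IsCantorWinning SchmidtCantor.bohrDilates :=
  ⟨⟨1 / 3, by norm_num, by norm_num, SchmidtCantor.isAlphaWinning_bohrDilates⟩,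
    SchmidtCantor.isAlphaWinning_bohrDilates,
    SchmidtCantor.isWeakAlphaWinning_of_sparse_scales
      fun _ hc ↦ SchmidtCantor.exists_sparse_scales hc,
    SchmidtCantor.not_isCantorWinning_bohrDilates⟩
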